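/- Let $\{x_k\}_{k\in\iota}$ be a finite or countably infinite family of variables, let $h$ be a further variable, and let $q_1,\dots,q_J$ ($J\ge 0$) be polynomials with complex coefficients in the noncommuting variables $h, x_k$ $(k\in\iota)$, where $q_j$ is homogeneous of degree $d_j\ge 1$ (it is a linear combination of words of length $d_j$). Let $C_k>0$ $(k\in\iota)$ and $D_j>0$ $(1\le j\le J)$ be constants. Then the universal $C^*$-algebra $$C^*\left\langle h,\ x_k\ (k\in\iota)\ \middle|\ 0\le h\le 1,\ \ -C_k h\le x_k\le C_k h\ (k\in\iota),\ \ \|q_j(h,\mathbf{x})\|\le D_j\ (1\le j\le J)\right\rangle$$ exists and is projective. Here $C^*$-algebras and $*$-homomorphisms are not required to be unital, and the inequality $h\le 1$ is read in the unitization. That $P$, with generators satisfying the relations, is the universal $C^*$-algebra means that every family in a $C^*$-algebra $A$ that satisfies the relations is the image of the generators under a unique $*$-homomorphism $P\to A$. That $P$ is projective means that for every surjective $*$-homomorphism $\rho:B\to C$ of $C^*$-algebras and every $*$-homomorphism $\varphi:P\to C$ there is a $*$-homomorphism $\psi:P\to B$ with $\rho\circ\psi=\varphi$. -/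

import Mathlib

universe u v

/-- NC polynomials in the noncommuting variables indexed by `X`: the elements of the free unital
associative complex algebra. -/
abbrev NCPoly (X : Type*) := FreeAlgebra ℂ X

/-- The NC polynomial `q` is homogeneous of degree `d`: it is a linear combination of words of
length `d` in the variables. -/
def NCPoly.IsHomogeneous {X : Type*} (q : NCPoly X) (d : ℕ) : Prop :=
  q ∈ Submodule.span ℂ {w : NCPoly X | ∃ l : List X, l.length = d ∧
    w = (l.map (FreeAlgebra.ι ℂ)).prod}

/-- The value of an NC polynomial at a family of elements of a C*-algebra `A`, as an element of
the unitization of `A`. (It lies in `A` when the constant term vanishes, and the C*-norm of the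
unitization extends the norm of `A`.) -/
noncomputable def NCPoly.eval {X : Type*} {A : Type*} [NonUnitalCStarAlgebra A]
    (v : X → A) (q : NCPoly X) : Unitization ℂ A :=
  FreeAlgebra.lift ℂ (fun i => ((v i : A) : Unitization ℂ A)) q

/-- A system of relations on the generators indexed by `X`: it says which families of elements
in which C*-algebras satisfy the relations. The order `≤` of each C*-algebra is the usual one,
`a ≤ b` iff `b - a` is positive; this is the content of `StarOrderedRing`. -/
abbrev CStarRelations (X : Type v) : Type (max v (u + 1)) :=
  ∀ (A : Type u) [NonUnitalCStarAlgebra A] [PartialOrder A] [StarOrderedRing A], (X → A) → Prop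

/-- `P`, with the generators `g`, is the universal C*-algebra of the system of relations `R`:
the family `g` satisfies the relations, and every family in a C*-algebra satisfying the relations
is the image of `g` under a unique *-homomorphism. -/
structure IsUniversalCStarAlgebra {X : Type v} (R : CStarRelations.{u, v} X)
    (P : Type u) [NonUnitalCStarAlgebra P] [PartialOrder P] [StarOrderedRing P]
    (g : X → P) : Prop where
  rel : R P g
  existsUnique_hom : ∀ (A : Type u) [NonUnitalCStarAlgebra A] [PartialOrder A] [StarOrderedRing A]
    (v : X → A), R A v → ∃! φ : P →⋆ₙₐ[ℂ] A, ∀ i, φ (g i) = v i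

/-- A C*-algebra `P` is projective if, for every surjective *-homomorphism `ρ : B → C` of
C*-algebras, every *-homomorphism `P → C` is of the form `ρ ∘ ψ`. Neither the algebras nor the
homomorphisms need be unital. -/
def IsProjectiveCStarAlgebra (P : Type u) [NonUnitalCStarAlgebra P] : Prop :=
  ∀ (B C : Type u) [NonUnitalCStarAlgebra B] [NonUnitalCStarAlgebra C] (ρ : B →⋆ₙₐ[ℂ] C),
    Function.Surjective ρ → ∀ φ : P →⋆ₙₐ[ℂ] C, ∃ ψ : P →⋆ₙₐ[ℂ] B, ρ.comp ψ = φ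

/-- The relations `0 ≤ h ≤ 1`, `-C k • h ≤ x k ≤ C k • h` for all `k`, and `‖q j (h, x)‖ ≤ D j`
for all `j`, where the generators are `h = v none` and `x k = v (some k)`. -/
structure ConeLikeRelations {ι : Type*} {J : ℕ} (C : ι → ℝ) (q : Fin J → NCPoly (Option ι))
    (D : Fin J → ℝ) (A : Type*) [NonUnitalCStarAlgebra A] [PartialOrder A] [StarOrderedRing A]
    (v : Option ι → A) : Prop where
  nonneg : 0 ≤ v none
  le_one : ((v none : A) : Unitization ℂ A) ≤ 1
  lower : ∀ k, -(C k • v none) ≤ v (some k)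
  upper : ∀ k, v (some k) ≤ C k • v none
  norm_le : ∀ j, ‖(q j).eval v‖ ≤ D j

open Filter Topology
open scoped ENNReal

/-! By the universal property, projectivity means that a family satisfying the relations in a
quotient lifts to a family satisfying them upstairs. After passing to unitizations the relations
split into two kinds.

The order relations lift because order intervals do (`StarAlgHom.exists_lift_Icc`): lift `h` from
`[0, 1]`, then each `x k + C k • h` from `[0, 2 C k • h]`.

The norm bounds are then enforced by compressing, `w ↦ u w u` with `u = 1 - δ e` and `e` from a
quasi-central approximate unit of the kernel. Conjugation preserves the order relations, and `u`
maps to `1`, so the family remains a lift. Since `e` almost commutes with everything, homogeneity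
gives `q (u w u) ≈ u ^ (2 d) * q w`. By convexity of powers this is dominated in norm by the
interpolation `(1 - e) Q + e ((1 - δ) ^ (2 d) Q)`, where `Q = q w`. Near the kernel's unit `1 - e`
sees only the image of `Q`, whose norm is at most `D`; hence the norm is at most `D + ε` once `(1 -
δ) ^ 2 ‖Q‖ ≤ D` (`StarAlgHom.exists_compression`). Repeating with `δ = 2 ^ (-n)` gives a Cauchy
sequence of lifts whose limit satisfies the bounds exactly
(`OrderConeRelations.exists_lift_norm_le`).

Existence is the usual construction: the relations bound the generators and can be tested in a
jointly isometric family of representations, so the C*-algebra generated inside an `ℓ^∞` product of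
models is universal. -/

theorem StarAlgHom.continuous_of_cstar {B C : Type*} [CStarAlgebra B] [CStarAlgebra C]
    (ρ : B →⋆ₐ[ℂ] C) : Continuous ρ :=
  AddMonoidHomClass.continuous_of_bound ρ 1 fun x => by
    rw [one_mul]; exact NonUnitalStarAlgHom.norm_apply_le ρ x

/-! ### Approximate units for the kernel of a `*`-homomorphism. -/

section ApproximateUnits

variable {B C : Type*} [CStarAlgebra B] [PartialOrder B] [StarOrderedRing B] [CStarAlgebra C]

theorem CStarAlgebra.norm_mul_le_of_mul_star_le {a b x : B} (ha : IsSelfAdjoint a)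
    (h : x * star x ≤ b) : ‖a * x‖ * ‖a * x‖ ≤ ‖a * b * a‖ := by
  rw [← CStarRing.norm_self_mul_star, star_mul, ha.star_eq]
  have h1 : a * x * (star x * a) = star a * (x * star x) * a := by
    rw [ha.star_eq]; simp only [mul_assoc]
  have h2 : a * b * a = star a * b * a := by rw [ha.star_eq]
  rw [h1, h2]
  exact CStarAlgebra.norm_le_norm_of_nonneg_of_le
    (star_left_conjugate_nonneg (mul_star_self_nonneg x) a) (star_left_conjugate_le_conjugate h a)

/-- Take `e = b / (b + δ)` with `b = ∑ i i*`. Then `i i* ≤ b` reduces the estimate to `δ² t / (t +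
δ)² ≤ δ`, and `δ = η²` because this bounds a squared norm. The absolute values in the formula only
serve to make the functions continuous on all of `ℝ`. -/
theorem StarAlgHom.exists_approx_unit_ker (ρ : B →⋆ₐ[ℂ] C) (G : Finset B)
    (hG : ∀ i ∈ G, ρ i = 0) {η : ℝ} (hη : 0 < η) :
    ∃ e : B, 0 ≤ e ∧ e ≤ 1 ∧ ρ e = 0 ∧ ∀ i ∈ G, ‖(1 - e) * i‖ ≤ η := by
  set b : B := ∑ i ∈ G, i * star i with hb
  have hb0 : 0 ≤ b := Finset.sum_nonneg fun i _ => mul_star_self_nonneg i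
  have hbs : IsSelfAdjoint b := .of_nonneg hb0
  set δ : ℝ := η ^ 2 with hδ
  have hδ0 : 0 < δ := by positivity
  have hpos : ∀ t : ℝ, 0 < |t| + δ := fun t => by positivity
  have hc1 : Continuous fun t : ℝ => |t| / (|t| + δ) :=
    continuous_abs.div₀ (by fun_prop) fun t => (hpos t).ne'
  have hc2 : Continuous fun t : ℝ => δ / (|t| + δ) :=
    continuous_const.div₀ (by fun_prop) fun t => (hpos t).ne'
  have hρb : ρ b = 0 := by
    rw [hb, map_sum]
    exact Finset.sum_eq_zero fun i hi => by rw [map_mul, hG i hi, zero_mul]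
  have h1e : 1 - cfc (fun t : ℝ => |t| / (|t| + δ)) b = cfc (fun t : ℝ => δ / (|t| + δ)) b := by
    rw [← cfc_const_one ℝ b, ← cfc_sub _ _ b (by fun_prop) hc1.continuousOn]
    refine cfc_congr fun t _ => ?_
    have := (hpos t).ne'
    field_simp
    ring
  refine ⟨cfc (fun t : ℝ => |t| / (|t| + δ)) b, cfc_nonneg fun t _ => by positivity,
    cfc_le_one _ _ fun t _ => (div_le_one (hpos t)).2 (by linarith), ?_, fun i hi => ?_⟩
  · have hcont := ρ.continuous_of_cstar
    rw [StarAlgHomClass.map_cfc ρ _ b hc1.continuousOn hcont hbs (hbs.map ρ), hρb, cfc_apply_zero]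
    simp
  · have h1 := CStarAlgebra.norm_mul_le_of_mul_star_le (x := i) (b := b)
      (a := 1 - cfc (fun t : ℝ => |t| / (|t| + δ)) b) (by rw [h1e]; exact cfc_predicate _ _)
      (Finset.single_le_sum (f := fun i => i * star i) (fun i _ => mul_star_self_nonneg i) hi)
    have h2 : ‖(1 - cfc (fun t : ℝ => |t| / (|t| + δ)) b) * b *
        (1 - cfc (fun t : ℝ => |t| / (|t| + δ)) b)‖ ≤ δ := by
      rw [h1e]
      have : cfc (fun t : ℝ => δ / (|t| + δ)) b * b * cfc (fun t : ℝ => δ / (|t| + δ)) b =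
          cfc (fun t : ℝ => δ / (|t| + δ) * t * (δ / (|t| + δ))) b := by
        rw [cfc_mul (fun t : ℝ => δ / (|t| + δ) * t) _ b (hc2.mul continuous_id).continuousOn
          hc2.continuousOn, cfc_mul _ (fun t : ℝ => t) b hc2.continuousOn (by fun_prop),
          cfc_id' ℝ b]
      rw [this]
      refine norm_cfc_le hδ0.le fun t ht => ?_
      rw [norm_mul, norm_mul, Real.norm_of_nonneg (by positivity : 0 ≤ δ / (|t| + δ)),
        Real.norm_eq_abs]
      have hp := hpos t
      rw [div_mul_eq_mul_div, div_mul_div_comm, div_le_iff₀ (by positivity)]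
      rw [show δ * |t| * δ = δ * (δ * |t|) by ring]
      exact mul_le_mul_of_nonneg_left (by nlinarith [abs_nonneg t]) hδ0.le
    have h3 := h1.trans h2
    rw [hδ, sq] at h3
    exact (le_abs_self _).trans (abs_le_of_sq_le_sq (by nlinarith) hη.le)

theorem StarAlgHom.exists_approx_unit_ker' (ρ : B →⋆ₐ[ℂ] C) (G : Finset B)
    (hG : ∀ i ∈ G, ρ i = 0) {η : ℝ} (hη : 0 < η) :
    ∃ e : B, 0 ≤ e ∧ e ≤ 1 ∧ ρ e = 0 ∧ ∀ i ∈ G, ‖(1 - e) * i‖ ≤ η ∧ ‖i * (1 - e)‖ ≤ η := by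
  classical
  obtain ⟨e, he0, he1, hρ, he⟩ := ρ.exists_approx_unit_ker (G ∪ G.image star) (fun i hi => by
    simp only [Finset.mem_union, Finset.mem_image] at hi
    obtain hi | ⟨j, hj, rfl⟩ := hi
    · exact hG i hi
    · rw [map_star, hG j hj, star_zero]) hη
  refine ⟨e, he0, he1, hρ, fun i hi => ⟨he i (by simp [hi]), ?_⟩⟩
  have h := he (star i) (Finset.mem_union_right _ (Finset.mem_image_of_mem _ hi))
  have hs : star ((1 - e) * star i) = i * (1 - e) := by
    simp [(IsSelfAdjoint.of_nonneg he0).star_eq]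
  rwa [← hs, norm_star]

/-- A functional restricted to the kernel is concentrated where it nearly attains its norm. If `a`
is nearly norming and `a (1 - e)` is small, then `a` and `b (1 - e)` are almost orthogonal. So `a +
t b (1 - e)` has norm `1 + O(t²)`, and a contribution of order `t` from `φ (b (1 - e))` would exceed
the supremum. -/
theorem StarAlgHom.exists_forall_ker_apply_le (ρ : B →⋆ₐ[ℂ] C) (φ : B →L[ℝ] ℝ) {η : ℝ}
    (hη : 0 < η) :
    ∃ e : B, ρ e = 0 ∧ ∀ b, ρ b = 0 → ‖b‖ ≤ 1 → |φ (b * (1 - e))| ≤ η := by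
  classical
  set S : Set ℝ := φ '' {b | ρ b = 0 ∧ ‖b‖ ≤ 1} with hS
  have hSne : S.Nonempty := ⟨φ 0, 0, by simp, rfl⟩
  have hSb : BddAbove S := ⟨‖φ‖, by
    rintro _ ⟨b, ⟨_, hb⟩, rfl⟩
    exact (le_abs_self _).trans ((φ.le_opNorm b).trans (mul_le_of_le_one_right (norm_nonneg _) hb))⟩
  set s := sSup S
  have hs0 : 0 ≤ s := le_csSup hSb ⟨0, by simp, by simp⟩
  have hsb : ∀ b, ρ b = 0 → ∀ r : ℝ, 0 < r → ‖b‖ ≤ r → φ b ≤ r * s := by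
    intro b hb r hr hbr
    have : φ (r⁻¹ • b) ≤ s := le_csSup hSb ⟨r⁻¹ • b, ⟨by
      rw [← Complex.coe_smul, map_smul, hb, smul_zero], by
      rw [norm_smul, norm_inv, Real.norm_of_nonneg hr.le]
      exact (inv_mul_le_one₀ hr).2 hbr⟩, rfl⟩
    rw [map_smul, smul_eq_mul, inv_mul_le_iff₀ hr] at this
    exact this
  obtain ⟨t, ht0, ht⟩ : ∃ t : ℝ, 0 < t ∧ t * (1 + 2 * s) ≤ η :=
    ⟨η / (1 + 2 * s), by positivity, by rw [div_mul_cancel₀ _ (by positivity)]⟩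
  obtain ⟨_, ⟨a, ⟨ha, ha1⟩, rfl⟩, has⟩ := exists_lt_of_lt_csSup hSne
    (show s - t ^ 2 < sSup S by have := pow_pos ht0 2; linarith)
  obtain ⟨e, he0, he1, hρe, he⟩ := ρ.exists_approx_unit_ker' {a} (by simpa using ha) ht0
  have hae : ‖a * (1 - e)‖ ≤ t := (he a (by simp)).2
  have hes : star (1 - e) = 1 - e := by simp [(IsSelfAdjoint.of_nonneg he0).star_eq]
  have he1' : ‖1 - e‖ ≤ 1 := by
    rw [CStarAlgebra.norm_le_one_iff_of_nonneg _ (sub_nonneg.2 he1)]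
    exact sub_le_self _ he0
  have key : ∀ b, ρ b = 0 → ‖b‖ ≤ 1 → φ (b * (1 - e)) ≤ η := by
    intro b hb hb1
    have hbe : ‖b * (1 - e)‖ ≤ 1 := (norm_mul_le _ _).trans (mul_le_one₀ hb1 (norm_nonneg _) he1')
    have hsm : ∀ x : B, ‖t • x‖ = t * ‖x‖ := fun x => by
      rw [norm_smul, Real.norm_of_nonneg ht0.le]
    -- The squared norm is at most `1 + 3 t²`: each cross term contains `a (1 - e)` or its adjoint,
    -- which supplies a second factor `t`.
    have hn : ‖a + t • (b * (1 - e))‖ ≤ 1 + t ^ 2 + t ^ 2 / 2 := by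
      have h1 : (a + t • (b * (1 - e))) * star (a + t • (b * (1 - e))) =
          a * star a + (t • (a * (1 - e) * star b) + t • (b * star (a * (1 - e)))) +
            (t • (b * (1 - e))) * star (t • (b * (1 - e))) := by
        simp only [star_add, star_smul, star_mul, hes, mul_add, add_mul, mul_assoc, smul_mul_assoc,
          mul_smul_comm, star_trivial, smul_add]
        abel
      have h2 : ‖(a + t • (b * (1 - e))) * star (a + t • (b * (1 - e)))‖ ≤
          1 + (t * t + t * t) + t * t := by
        rw [h1]
        refine norm_add_le_of_le (norm_add_le_of_le ?_ (norm_add_le_of_le ?_ ?_)) ?_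
        · rw [CStarRing.norm_self_mul_star]; exact mul_le_one₀ ha1 (norm_nonneg _) ha1
        · rw [hsm]
          refine mul_le_mul_of_nonneg_left ((norm_mul_le _ _).trans ?_) ht0.le
          rw [norm_star]
          exact (mul_le_of_le_one_right (norm_nonneg _) hb1).trans hae
        · rw [hsm]
          refine mul_le_mul_of_nonneg_left ((norm_mul_le _ _).trans ?_) ht0.le
          rw [norm_star]
          exact (mul_le_of_le_one_left (norm_nonneg _) hb1).trans hae
        · rw [CStarRing.norm_self_mul_star, hsm]
          have : t * ‖b * (1 - e)‖ ≤ t := mul_le_of_le_one_right ht0.le hbe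
          exact mul_le_mul this this (by positivity) ht0.le
      rw [CStarRing.norm_self_mul_star] at h2
      refine (le_abs_self _).trans (abs_le_of_sq_le_sq ?_ (by positivity))
      nlinarith [sq_nonneg (t ^ 2)]
    have h3 := hsb (a + t • (b * (1 - e))) (by
      rw [map_add, ← Complex.coe_smul, map_smul, map_mul, ha, hb]; simp) _ (by positivity) hn
    rw [map_add, map_smul, smul_eq_mul] at h3
    have h4 : t * φ (b * (1 - e)) ≤ t * (t * (1 + 2 * s)) := by
      nlinarith [mul_nonneg (sq_nonneg t) hs0]
    exact (le_of_mul_le_mul_left h4 ht0).trans ht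
  refine ⟨e, hρe, fun b hb hb1 => abs_le.2 ⟨?_, key b hb hb1⟩⟩
  have := key (-b) (by simp [hb]) (by simpa using hb1)
  rw [neg_mul, map_neg] at this
  linarith

end ApproximateUnits

/-! ### Quasi-central approximate units. -/

section QuasiCentral

variable {B C : Type*} [CStarAlgebra B] [PartialOrder B] [StarOrderedRing B] [CStarAlgebra C]

/-- The admissible `e` form a convex set, so it suffices that no functional separates their
commutators with `F` from `0`. Approximate units make such commutators weakly small, and Hahn–Banach
turns weak smallness into norm smallness. -/
theorem StarAlgHom.exists_quasicentral_finset (ρ : B →⋆ₐ[ℂ] C) (F G : Finset B)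
    (hG : ∀ i ∈ G, ρ i = 0) {ε : ℝ} (hε : 0 < ε) :
    ∃ e : B, 0 ≤ e ∧ e ≤ 1 ∧ ρ e = 0 ∧ (∀ x ∈ F, ‖e * x - x * e‖ ≤ ε) ∧
      ∀ i ∈ G, ‖(1 - e) * i‖ ≤ ε := by
  classical
  set K : Set B := {e | 0 ≤ e ∧ e ≤ 1 ∧ ρ e = 0 ∧ ∀ i ∈ G, ‖(1 - e) * i‖ ≤ ε} with hK
  have hKc : Convex ℝ K := by
    rintro a ⟨ha0, ha1, hρa, ha⟩ b ⟨hb0, hb1, hρb, hb⟩ s t hs ht hst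
    have h1 : (1 : B) = s • 1 + t • 1 := by rw [← add_smul, hst, one_smul]
    refine ⟨add_nonneg (smul_nonneg hs ha0) (smul_nonneg ht hb0), ?_, ?_, fun i hi => ?_⟩
    · rw [h1]
      exact add_le_add (smul_le_smul_of_nonneg_left ha1 hs) (smul_le_smul_of_nonneg_left hb1 ht)
    · rw [map_add, ← Complex.coe_smul, ← Complex.coe_smul, map_smul, map_smul, hρa, hρb]; simp
    · have h2 : (1 - (s • a + t • b)) * i = s • ((1 - a) * i) + t • ((1 - b) * i) := by
        nth_rw 1 [h1]
        simp only [sub_mul, add_mul, smul_sub, smul_mul_assoc]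
        abel
      rw [h2]
      refine (norm_add_le _ _).trans ?_
      rw [norm_smul, norm_smul, Real.norm_of_nonneg hs, Real.norm_of_nonneg ht]
      calc s * ‖(1 - a) * i‖ + t * ‖(1 - b) * i‖ ≤ s * ε + t * ε := by
            gcongr
            · exact ha i hi
            · exact hb i hi
        _ = ε := by rw [← add_mul, hst, one_mul]
  let T : B →ₗ[ℝ] (F → B) :=
    LinearMap.pi fun x => LinearMap.mulRight ℝ (x : B) - LinearMap.mulLeft ℝ (x : B)
  have hT : ∀ e x, T e x = e * x - x * e := fun e x => rfl
  suffices h : (0 : F → B) ∈ closure (T '' K) by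
    obtain ⟨_, ⟨e, he, rfl⟩, hd⟩ := Metric.mem_closure_iff.1 h ε hε
    rw [dist_zero_left, pi_norm_lt_iff hε] at hd
    exact ⟨e, he.1, he.2.1, he.2.2.1, fun x hx => (hd ⟨x, hx⟩).le, he.2.2.2⟩
  by_contra hcl
  obtain ⟨φ, u, hφ, hu⟩ := geometric_hahn_banach_closed_point
    ((hKc.linear_image T).closure) isClosed_closure hcl
  rw [map_zero] at hu
  let ψ : F → (B →L[ℝ] ℝ) := fun x => φ.comp (ContinuousLinearMap.single ℝ (fun _ : F => B) x)
  have hψ : ∀ e, φ (T e) = ∑ x : F, ψ x (e * x - x * e) := fun e => by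
    conv_lhs => rw [← Finset.univ_sum_single (T e), map_sum]
    rfl
  -- Each of the `card F` commutators will contribute four errors of size `κ`; the `+ 1` makes the
  -- total strictly smaller than `-u`.
  set κ : ℝ := -u / (4 * (Fintype.card F + 1)) with hκ
  have hκ0 : 0 < κ := by have : 0 < -u := by linarith
                         positivity
  choose d hρd hd using fun x : F => ρ.exists_forall_ker_apply_le (ψ x)
    (η := κ / (‖(x : B)‖ + 1)) (by positivity)
  have hd' : ∀ (x : F) (b : B), ρ b = 0 → ‖b‖ ≤ ‖(x : B)‖ → |ψ x (b * (1 - d x))| ≤ κ := by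
    intro x b hb hbx
    have hp : 0 < ‖(x : B)‖ + 1 := by positivity
    have h1 := hd x ((‖(x : B)‖ + 1)⁻¹ • b) (by
      rw [← Complex.coe_smul, map_smul, hb, smul_zero]) (by
      rw [norm_smul, norm_inv, Real.norm_of_nonneg hp.le]
      exact (inv_mul_le_one₀ hp).2 (by linarith))
    rw [smul_mul_assoc, map_smul, smul_eq_mul, abs_mul, abs_inv, abs_of_pos hp,
      inv_mul_le_iff₀ hp, mul_div_cancel₀ _ hp.ne'] at h1
    exact h1
  set M : ℝ := 1 + ∑ x : F, ‖ψ x‖ * (1 + ‖(x : B)‖) with hM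
  have hM0 : 0 < M := by positivity
  have hMx : ∀ x : F, ‖ψ x‖ * (1 + ‖(x : B)‖) ≤ M := fun x => by
    have := Finset.single_le_sum (f := fun x : F => ‖ψ x‖ * (1 + ‖(x : B)‖))
      (fun x _ => by positivity) (Finset.mem_univ x)
    linarith
  obtain ⟨e, he0, he1, hρe, he⟩ := ρ.exists_approx_unit_ker
    (G ∪ (Finset.univ.image (fun x : F => (x : B) * d x) ∪ Finset.univ.image d)) (by
      intro i hi
      simp only [Finset.mem_union, Finset.mem_image, Finset.mem_univ, true_and] at hi
      obtain hi | ⟨x, rfl⟩ | ⟨x, rfl⟩ := hi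
      · exact hG i hi
      · rw [map_mul, hρd, mul_zero]
      · exact hρd x) (η := min ε (κ / M)) (by positivity)
  have heK : e ∈ K := ⟨he0, he1, hρe, fun i hi =>
    (he i (Finset.mem_union_left _ hi)).trans (min_le_left _ _)⟩
  have hen : ‖e‖ ≤ 1 := (CStarAlgebra.norm_le_one_iff_of_nonneg e he0).2 he1
  have hlt := hφ _ (subset_closure ⟨e, heK, rfl⟩)
  rw [hψ] at hlt
  have hterm : ∀ x : F, -(4 * κ) ≤ ψ x (e * x - x * e) := by
    intro x
    -- The first two terms are small under `ψ x` by the choice of `d x`, the last two are small in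
    -- norm by the choice of `e`.
    have e1 : e * x - x * e = e * x * (1 - d x) - x * e * (1 - d x) -
        (1 - e) * (x * d x) + x * ((1 - e) * d x) := by noncomm_ring
    have b1 := hd' x (e * x) (by rw [map_mul, hρe, zero_mul])
      ((norm_mul_le _ _).trans (mul_le_of_le_one_left (norm_nonneg _) hen))
    have b2 := hd' x (x * e) (by rw [map_mul, hρe, mul_zero])
      ((norm_mul_le _ _).trans (mul_le_of_le_one_right (norm_nonneg _) hen))
    have b3 : |ψ x ((1 - e) * (x * d x))| ≤ κ := by
      refine ((ψ x).le_opNorm _).trans ?_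
      have h1 := (he (x * d x) (by simp)).trans (min_le_right _ _)
      calc ‖ψ x‖ * ‖(1 - e) * (x * d x)‖ ≤ M * (κ / M) := by
            refine mul_le_mul ?_ h1 (norm_nonneg _) hM0.le
            exact (le_mul_of_one_le_right (norm_nonneg _) (by simp)).trans (hMx x)
        _ = κ := mul_div_cancel₀ _ hM0.ne'
    have b4 : |ψ x (x * ((1 - e) * d x))| ≤ κ := by
      refine ((ψ x).le_opNorm _).trans ?_
      have h1 := (he (d x) (by simp)).trans (min_le_right _ _)
      calc ‖ψ x‖ * ‖x * ((1 - e) * d x)‖ ≤ ‖ψ x‖ * (‖(x : B)‖ * ‖(1 - e) * d x‖) := by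
            gcongr; exact norm_mul_le _ _
        _ = (‖ψ x‖ * ‖(x : B)‖) * ‖(1 - e) * d x‖ := by ring
        _ ≤ M * (κ / M) := by
            refine mul_le_mul ?_ h1 (norm_nonneg _) hM0.le
            refine le_trans ?_ (hMx x)
            gcongr
            linarith
        _ = κ := mul_div_cancel₀ _ hM0.ne'
    rw [e1, map_add, map_sub, map_sub]
    rw [abs_le] at b1 b2 b3 b4
    linarith [b1.1, b2.2, b3.2, b4.1]
  have hsum := Finset.sum_le_sum fun x (_ : x ∈ Finset.univ) => hterm x
  rw [Finset.sum_const, Finset.card_univ, nsmul_eq_mul] at hsum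
  have : κ * (4 * (Fintype.card F + 1)) = -u := div_mul_cancel₀ _ (by positivity)
  nlinarith

/-- A quasi-central approximate unit for the kernel of a `*`-homomorphism. -/
theorem StarAlgHom.exists_quasicentral_approx_unit (ρ : B →⋆ₐ[ℂ] C) :
    ∃ l : Filter B, l.NeBot ∧ (∀ᶠ e in l, 0 ≤ e ∧ e ≤ 1 ∧ ρ e = 0) ∧
      (∀ x, Tendsto (fun e => e * x - x * e) l (𝓝 0)) ∧
      ∀ i, ρ i = 0 → Tendsto (fun e => (1 - e) * i) l (𝓝 0) := by
  classical
  choose f hf0 hf1 hfρ hfc hfi using fun p : Finset B × ℕ =>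
    ρ.exists_quasicentral_finset p.1 (p.1.filter fun i => ρ i = 0)
      (fun i hi => (Finset.mem_filter.1 hi).2) (ε := 1 / ((p.2 : ℝ) + 1)) (by positivity)
  have hlim : Tendsto (fun p : Finset B × ℕ => 1 / ((p.2 : ℝ) + 1)) atTop (𝓝 0) := by
    rw [← prod_atTop_atTop_eq]
    exact tendsto_one_div_add_atTop_nhds_zero_nat.comp tendsto_snd
  have hmem : ∀ x : B, ∀ᶠ p : Finset B × ℕ in atTop, x ∈ p.1 := fun x => by
    filter_upwards [eventually_ge_atTop (({x} : Finset B), 0)] with p hp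
    exact hp.1 (Finset.mem_singleton_self x)
  refine ⟨map f atTop, inferInstance, ?_, fun x => ?_, fun i hi => ?_⟩
  · exact eventually_map.2 <| Eventually.of_forall fun p => ⟨hf0 p, hf1 p, hfρ p⟩
  · refine tendsto_map'_iff.2 (squeeze_zero_norm' ?_ hlim)
    filter_upwards [hmem x] with p hp using hfc p x hp
  · refine tendsto_map'_iff.2 (squeeze_zero_norm' ?_ hlim)
    filter_upwards [hmem i] with p hp using hfi p i (Finset.mem_filter.2 ⟨hp, hi⟩)

end QuasiCentral

/-! ### Asymptotic commutation passes to continuous functions. -/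

section Commutators

theorem tendsto_commutator_mul {B : Type*} [NormedRing B] {α : Type*} {l : Filter α}
    {f g : α → B} {x : B} {c d : ℝ} (hf : ∀ᶠ a in l, ‖f a‖ ≤ c) (hg : ∀ᶠ a in l, ‖g a‖ ≤ d)
    (hfx : Tendsto (fun a => f a * x - x * f a) l (𝓝 0))
    (hgx : Tendsto (fun a => g a * x - x * g a) l (𝓝 0)) :
    Tendsto (fun a => f a * g a * x - x * (f a * g a)) l (𝓝 0) := by
  have h1 : Tendsto (fun a => f a * (g a * x - x * g a)) l (𝓝 0) :=
    isBoundedUnder_le_mul_tendsto_zero (isBoundedUnder_of_eventually_le hf) hgx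
  have h2 : Tendsto (fun a => (f a * x - x * f a) * g a) l (𝓝 0) :=
    hfx.zero_mul_isBoundedUnder_le (isBoundedUnder_of_eventually_le hg)
  have h3 := h1.add h2
  rw [add_zero] at h3
  refine h3.congr fun a => ?_
  noncomm_ring

variable {B : Type*} [CStarAlgebra B] [PartialOrder B] [StarOrderedRing B]

theorem spectrum_subset_Icc_of_mem_Icc {e : B} (h0 : 0 ≤ e) (h1 : e ≤ 1) :
    spectrum ℝ e ⊆ Set.Icc 0 1 := by
  intro t ht
  refine ⟨spectrum_nonneg_of_nonneg h0 ht, ?_⟩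
  have := (CStarAlgebra.norm_le_one_iff_of_nonneg e h0).2 h1
  rcases subsingleton_or_nontrivial B with _ | _
  · rw [spectrum.of_subsingleton] at ht
    exact ht.elim
  exact (le_abs_self t).trans ((spectrum.norm_le_norm_of_mem ht).trans this)

/-- Polynomials follow from the product rule for commutators, and Weierstrass approximation on `[0,
1]` is uniform over all `e` in the order interval. -/
theorem tendsto_commutator_cfc {l : Filter B} (hl : ∀ᶠ e in l, 0 ≤ e ∧ e ≤ 1) {x : B}
    (hx : Tendsto (fun e => e * x - x * e) l (𝓝 0)) {f : ℝ → ℝ}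
    (hf : ContinuousOn f (Set.Icc 0 1)) :
    Tendsto (fun e => cfc f e * x - x * cfc f e) l (𝓝 0) := by
  have hpoly : ∀ p : Polynomial ℝ,
      Tendsto (fun e => Polynomial.aeval e p * x - x * Polynomial.aeval e p) l (𝓝 0) := by
    intro p
    induction p using Polynomial.induction_on' with
    | add p q hp hq =>
      have := hp.add hq
      rw [add_zero] at this
      refine this.congr fun e => ?_
      rw [map_add]
      noncomm_ring
    | monomial n a =>
      have hpow : Tendsto (fun e : B => e ^ n * x - x * e ^ n) l (𝓝 0) := by
        induction n with
        | zero => simpa using tendsto_const_nhds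
        | succ n ih =>
          simp only [pow_succ]
          have hn : ∀ᶠ e in l, ‖e‖ ≤ 1 := hl.mono fun e he =>
            (CStarAlgebra.norm_le_one_iff_of_nonneg e he.1).2 he.2
          refine tendsto_commutator_mul (c := ‖(1 : B)‖ + 1) (hn.mono fun e he => ?_) hn ih hx
          rcases n with _ | n
          · simp
          · exact ((norm_pow_le' e n.succ_pos).trans (pow_le_one₀ (norm_nonneg _) he)).trans
              (by simp)
      have := hpow.const_smul a
      rw [smul_zero] at this
      refine this.congr fun e => ?_
      rw [Polynomial.aeval_monomial, ← Algebra.smul_def, smul_sub, smul_mul_assoc, mul_smul_comm]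
  rw [Metric.tendsto_nhds]
  intro ε hε
  set η : ℝ := ε / (2 * (‖x‖ + 1) + 1) with hη
  have hη0 : 0 < η := by positivity
  obtain ⟨p, hp⟩ := exists_polynomial_near_of_continuousOn 0 1 f hf η hη0
  filter_upwards [hl, Metric.tendsto_nhds.1 (hpoly p) η hη0] with e he hpe
  rw [dist_zero_right] at hpe ⊢
  have hs := spectrum_subset_Icc_of_mem_Icc he.1 he.2
  have hd : ‖cfc f e - Polynomial.aeval e p‖ ≤ η := by
    rw [← cfc_polynomial p e (.of_nonneg he.1),
      ← cfc_sub f _ e (hf.mono hs) (by fun_prop)]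
    refine norm_cfc_le hη0.le fun t ht => ?_
    rw [Real.norm_eq_abs, abs_sub_comm]
    exact (hp t (hs ht)).le
  have heq : cfc f e * x - x * cfc f e = (cfc f e - Polynomial.aeval e p) * x -
      x * (cfc f e - Polynomial.aeval e p) +
      (Polynomial.aeval e p * x - x * Polynomial.aeval e p) := by noncomm_ring
  rw [heq]
  calc _ ≤ η * ‖x‖ + ‖x‖ * η + ‖Polynomial.aeval e p * x - x * Polynomial.aeval e p‖ := by
        refine norm_add_le_of_le (norm_sub_le_of_le ?_ ?_) le_rfl
        · exact (norm_mul_le _ _).trans (mul_le_mul_of_nonneg_right hd (norm_nonneg _))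
        · exact (norm_mul_le _ _).trans (mul_le_mul_of_nonneg_left hd (norm_nonneg _))
    _ < η * ‖x‖ + ‖x‖ * η + η := by linarith
    _ ≤ η * (2 * (‖x‖ + 1) + 1) := by nlinarith [norm_nonneg x]
    _ = ε := div_mul_cancel₀ _ (by positivity)

end Commutators

/-! ### Norm estimates for operator convex combinations. -/

section Interpolation

theorem norm_star_mul_self_sub_le {B : Type*} [CStarAlgebra B] {a b : B} {M : ℝ} (ha : ‖a‖ ≤ M) (hb : ‖b‖ ≤ M) :
    ‖star a * a - star b * b‖ ≤ 2 * M * ‖a - b‖ := by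
  have h : star a * a - star b * b = star a * (a - b) + star (a - b) * b := by
    rw [star_sub]; noncomm_ring
  rw [h]
  calc _ ≤ M * ‖a - b‖ + ‖a - b‖ * M := by
        refine norm_add_le_of_le ?_ ?_
        · refine (norm_mul_le _ _).trans ?_
          rw [norm_star]
          gcongr
        · refine (norm_mul_le _ _).trans ?_
          rw [norm_star]
          gcongr
    _ = 2 * M * ‖a - b‖ := by ring

variable {B : Type*} [CStarAlgebra B] [PartialOrder B] [StarOrderedRing B]

/-- The norm of a convex combination with operator coefficients `1 - e` and `e` that almost commute
with the summands. -/
theorem norm_interpolation_le {e X Y : B} (h0 : 0 ≤ e) (h1 : e ≤ 1) {M ε : ℝ}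
    (hX : ‖X‖ ≤ M) (hY : ‖Y‖ ≤ M) (hε : 0 ≤ ε)
    (hcX : ‖cfc (fun t : ℝ => √(1 - t)) e * X - X * cfc (fun t : ℝ => √(1 - t)) e‖ ≤ ε / 2)
    (hcY : ‖cfc Real.sqrt e * Y - Y * cfc Real.sqrt e‖ ≤ ε / 2) :
    ‖(1 - e) * X + e * Y‖ ≤ M + ε := by
  have hM : 0 ≤ M := (norm_nonneg X).trans hX
  have hes : IsSelfAdjoint e := .of_nonneg h0
  have hsp := spectrum_subset_Icc_of_mem_Icc h0 h1
  set c := cfc (fun t : ℝ => √(1 - t)) e with hc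
  set s := cfc Real.sqrt e with hs
  have hcs : star c = c := (cfc_predicate _ e : IsSelfAdjoint c)
  have hss : star s = s := (cfc_predicate _ e : IsSelfAdjoint s)
  have hss' : s * s = e := by
    rw [hs, ← cfc_mul _ _ e (by fun_prop) (by fun_prop)]
    conv_rhs => rw [← cfc_id' ℝ e]
    exact cfc_congr fun t ht => Real.mul_self_sqrt (hsp ht).1
  have hcc : c * c = 1 - e := by
    rw [hc, ← cfc_mul _ _ e (by fun_prop) (by fun_prop)]
    conv_rhs => rw [← cfc_id' ℝ e, ← cfc_const_one ℝ e, ← cfc_sub _ _ e (by fun_prop) (by fun_prop)]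
    exact cfc_congr fun t ht => Real.mul_self_sqrt (sub_nonneg.2 (hsp ht).2)
  have hc1 : ‖c‖ ≤ 1 := norm_cfc_le zero_le_one fun t ht => by
    rw [Real.norm_of_nonneg (Real.sqrt_nonneg _)]
    exact Real.sqrt_le_one.2 (by linarith [(hsp ht).1])
  have hs1 : ‖s‖ ≤ 1 := norm_cfc_le zero_le_one fun t ht => by
    rw [Real.norm_of_nonneg (Real.sqrt_nonneg _)]
    exact Real.sqrt_le_one.2 (hsp ht).2
  set T := (1 - e) * X + e * Y with hT
  set R := star (c * X) * (c * X) + star (s * Y) * (s * Y) with hR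
  set S := star (X * c) * (X * c) + star (Y * s) * (Y * s) with hS
  -- Operator convexity of the square: the difference is `(X - Y)* (e - e²) (X - Y)`.
  have hTR : star T * T ≤ R := by
    have he2 : 0 ≤ e - e * e := by
      have : e - e * e = star e * (1 - e) * e + star (1 - e) * e * (1 - e) := by
        rw [star_sub, star_one, hes.star_eq]; noncomm_ring
      rw [this]
      exact add_nonneg (star_left_conjugate_nonneg (sub_nonneg.2 h1) _)
        (star_left_conjugate_nonneg h0 _)
    have : R - star T * T = star (X - Y) * (e - e * e) * (X - Y) := by
      have hR' : R = star X * (1 - e) * X + star Y * e * Y := by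
        rw [hR, ← hcc]
        conv_rhs => rw [← hss']
        simp only [star_mul, hcs, hss, mul_assoc]
      rw [hR', hT]
      simp only [star_add, star_sub, star_mul, star_one, hes.star_eq]
      noncomm_ring
    rw [← sub_nonneg, this]
    exact star_left_conjugate_nonneg he2 _
  -- With the square roots on the outside, `X* X` and `Y* Y` can be replaced by `M²`, and `c² + s² =
  -- 1`. Passing from `R` to `S` costs only the commutators.
  have hSM : ‖S‖ ≤ M ^ 2 := by
    have hS0 : 0 ≤ S := add_nonneg (star_mul_self_nonneg _) (star_mul_self_nonneg _)
    rw [CStarAlgebra.norm_le_iff_le_algebraMap S (sq_nonneg M) hS0]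
    have key : ∀ z a : B, ‖z‖ ≤ M → star (z * a) * (z * a) ≤ M ^ 2 • (star a * a) := by
      intro z a hz
      have h1 := CStarAlgebra.star_left_conjugate_le_norm_smul (a := a) (b := star z * z)
        (.star_mul_self z)
      have h2 : star (z * a) * (z * a) = star a * (star z * z) * a := by
        simp only [star_mul, mul_assoc]
      rw [h2]
      refine h1.trans (smul_le_smul_of_nonneg_right ?_ (star_mul_self_nonneg a))
      rw [CStarRing.norm_star_mul_self, ← sq]
      gcongr
    refine (add_le_add (key X c hX) (key Y s hY)).trans ?_
    rw [hcs, hss, hcc, hss', ← smul_add, sub_add_cancel, Algebra.algebraMap_eq_smul_one]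
  have hRS : ‖R - S‖ ≤ 2 * M * ε := by
    have : R - S = (star (c * X) * (c * X) - star (X * c) * (X * c)) +
        (star (s * Y) * (s * Y) - star (Y * s) * (Y * s)) := by rw [hR, hS]; abel
    rw [this]
    calc _ ≤ 2 * M * (ε / 2) + 2 * M * (ε / 2) := by
          refine norm_add_le_of_le ?_ ?_
          · refine (norm_star_mul_self_sub_le (M := M) ?_ ?_).trans (by gcongr)
            · exact (norm_mul_le _ _).trans ((mul_le_of_le_one_left (norm_nonneg _) hc1).trans hX)
            · exact (norm_mul_le _ _).trans ((mul_le_of_le_one_right (norm_nonneg _) hc1).trans hX)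
          · refine (norm_star_mul_self_sub_le (M := M) ?_ ?_).trans (by gcongr)
            · exact (norm_mul_le _ _).trans ((mul_le_of_le_one_left (norm_nonneg _) hs1).trans hY)
            · exact (norm_mul_le _ _).trans ((mul_le_of_le_one_right (norm_nonneg _) hs1).trans hY)
      _ = 2 * M * ε := by ring
  have hTT : ‖T‖ * ‖T‖ ≤ (M + ε) ^ 2 := by
    rw [← CStarRing.norm_star_mul_self]
    calc ‖star T * T‖ ≤ ‖R‖ := CStarAlgebra.norm_le_norm_of_nonneg_of_le
          (star_mul_self_nonneg T) hTR
      _ = ‖S + (R - S)‖ := by rw [add_sub_cancel]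
      _ ≤ M ^ 2 + 2 * M * ε := norm_add_le_of_le hSM hRS
      _ ≤ (M + ε) ^ 2 := by nlinarith [sq_nonneg ε]
  rw [← sq] at hTT
  exact (le_abs_self _).trans (abs_le_of_sq_le_sq hTT (by positivity))

theorem eventually_norm_interpolation_le {l : Filter B} (hl : ∀ᶠ e in l, 0 ≤ e ∧ e ≤ 1) {X Y : B}
    (hlX : Tendsto (fun e => e * X - X * e) l (𝓝 0))
    (hlY : Tendsto (fun e => e * Y - Y * e) l (𝓝 0)) {M ε : ℝ}
    (hX : ‖X‖ ≤ M) (hY : ‖Y‖ ≤ M) (hε : 0 < ε) :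
    ∀ᶠ e in l, ‖(1 - e) * X + e * Y‖ ≤ M + ε := by
  have h1 := tendsto_commutator_cfc hl hlX (f := fun t : ℝ => √(1 - t)) (by fun_prop)
  have h2 := tendsto_commutator_cfc hl hlY (f := Real.sqrt) (by fun_prop)
  filter_upwards [hl, Metric.tendsto_nhds.1 h1 (ε / 2) (by positivity),
    Metric.tendsto_nhds.1 h2 (ε / 2) (by positivity)] with e he h3 h4
  rw [dist_zero_right] at h3 h4
  exact norm_interpolation_le he.1 he.2 hX hY hε.le h3.le h4.le

theorem norm_mul_le_of_cfc_le {e Q : B} {f g : ℝ → ℝ}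
    (hf : ContinuousOn f (spectrum ℝ e)) (hg : ContinuousOn g (spectrum ℝ e))
    (hf0 : ∀ t ∈ spectrum ℝ e, 0 ≤ f t) (hfg : ∀ t ∈ spectrum ℝ e, f t ≤ g t) :
    ‖cfc f e * Q‖ ≤ ‖cfc g e * Q‖ := by
  have key : ∀ h : ℝ → ℝ, ContinuousOn h (spectrum ℝ e) →
      star (cfc h e * Q) * (cfc h e * Q) = star Q * cfc (fun t => h t * h t) e * Q := by
    intro h hh
    rw [star_mul, (cfc_predicate h e : IsSelfAdjoint (cfc h e)).star_eq, cfc_mul h h e hh hh]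
    simp only [mul_assoc]
  have hsq : ‖cfc f e * Q‖ * ‖cfc f e * Q‖ ≤ ‖cfc g e * Q‖ * ‖cfc g e * Q‖ := by
    rw [← CStarRing.norm_star_mul_self, ← CStarRing.norm_star_mul_self]
    refine CStarAlgebra.norm_le_norm_of_nonneg_of_le (star_mul_self_nonneg _) ?_
    rw [key f hf, key g hg]
    refine star_left_conjugate_le_conjugate (cfc_mono (fun t ht => ?_) (hf.mul hf) (hg.mul hg)) _
    exact mul_self_le_mul_self (hf0 t ht) (hfg t ht)
  exact (mul_self_le_mul_self_iff (norm_nonneg _) (norm_nonneg _)).2 hsq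

theorem one_sub_mul_pow_le {δ t : ℝ} (hδ : δ ≤ 1) (ht : t ∈ Set.Icc (0 : ℝ) 1) (n : ℕ) :
    (1 - δ * t) ^ n ≤ 1 - (1 - (1 - δ) ^ n) * t := by
  have h := (convexOn_pow n).2 (Set.mem_Ici.2 zero_le_one) (Set.mem_Ici.2 (sub_nonneg.2 hδ))
    (sub_nonneg.2 ht.2) ht.1 (by ring)
  simp only [smul_eq_mul, one_pow] at h
  calc (1 - δ * t) ^ n = ((1 - t) * 1 + t * (1 - δ)) ^ n := by ring
    _ ≤ _ := h
    _ = _ := by ring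

/-- On `[0, 1]` the power `(1 - δ t) ^ n` lies below its chord, and the chord evaluated at `e` is
the interpolation on the right. This brings powers of `1 - δ e` within reach of
`norm_interpolation_le`. -/
theorem norm_one_sub_smul_pow_mul_le {e Q : B} (h0 : 0 ≤ e) (h1 : e ≤ 1) {δ : ℝ}
    (hδ0 : 0 ≤ δ) (hδ : δ ≤ 1) (n : ℕ) :
    ‖(1 - δ • e) ^ n * Q‖ ≤ ‖(1 - e) * Q + e * ((1 - δ) ^ n • Q)‖ := by
  have hes : IsSelfAdjoint e := .of_nonneg h0
  have hsp := spectrum_subset_Icc_of_mem_Icc h0 h1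
  have hlin : ∀ r : ℝ, cfc (fun t : ℝ => 1 - r * t) e = 1 - r • e := fun r => by
    rw [cfc_sub _ _ e (by fun_prop) (by fun_prop), cfc_const_one ℝ e, cfc_const_mul_id r e]
  have h2 : (1 - e) * Q + e * ((1 - δ) ^ n • Q) = (1 - (1 - (1 - δ) ^ n) • e) * Q := by
    simp only [sub_mul, sub_smul, one_mul, one_smul, smul_mul_assoc, mul_smul_comm]
    abel
  rw [h2, ← hlin, ← hlin, ← cfc_pow _ n e (by fun_prop)]
  refine norm_mul_le_of_cfc_le (by fun_prop) (by fun_prop) (fun t ht => ?_) fun t ht =>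
    one_sub_mul_pow_le hδ (hsp ht) n
  exact pow_nonneg (by nlinarith [(hsp ht).1, (hsp ht).2]) n

end Interpolation

/-! ### Homogeneous polynomials under almost central conjugation. -/

section Homogeneous

variable {B : Type*} [NormedRing B] [NormedAlgebra ℂ B] {X α : Type*} {l : Filter α}

theorem tendsto_commutator_pow {B α : Type*} [NormedRing B] {l : Filter α} {u : α → B} {x : B} (hu : ∀ᶠ a in l, ‖u a‖ ≤ 1)
    (hx : Tendsto (fun a => u a * x - x * u a) l (𝓝 0)) (n : ℕ) :
    Tendsto (fun a => u a ^ n * x - x * u a ^ n) l (𝓝 0) := by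
  induction n with
  | zero => simpa using tendsto_const_nhds
  | succ n ih =>
    simp only [pow_succ]
    refine tendsto_commutator_mul (c := ‖(1 : B)‖ + 1) (hu.mono fun a ha => ?_) hu ih hx
    rcases n with _ | n
    · simp
    · exact ((norm_pow_le' _ n.succ_pos).trans (pow_le_one₀ (norm_nonneg _) ha)).trans (by simp)

/-- In a word of length `d` each letter brings two factors `u`, and all of them can be moved to the
left in the limit. Homogeneity gives every word the same power. -/
theorem NCPoly.IsHomogeneous.tendsto_lift_conj {q : NCPoly X} {d : ℕ} (hq : q.IsHomogeneous d)
    (w : X → B) {u : α → B} (hu : ∀ᶠ a in l, ‖u a‖ ≤ 1)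
    (hw : ∀ k, Tendsto (fun a => u a * w k - w k * u a) l (𝓝 0)) :
    Tendsto (fun a => FreeAlgebra.lift ℂ (fun k => u a * w k * u a) q -
      u a ^ (2 * d) * FreeAlgebra.lift ℂ w q) l (𝓝 0) := by
  refine Submodule.span_induction (p := fun q _ => Tendsto
    (fun a => FreeAlgebra.lift ℂ (fun k => u a * w k * u a) q -
      u a ^ (2 * d) * FreeAlgebra.lift ℂ w q) l (𝓝 0)) ?_ ?_ ?_ ?_ hq
  · rintro _ ⟨L, rfl, rfl⟩
    clear hq
    induction L with
    | nil => simpa using tendsto_const_nhds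
    | cons k L ih =>
      simp only [List.map_cons, List.prod_cons, map_mul, FreeAlgebra.lift_ι_apply,
        List.length_cons]
      have hb1 : ∀ᶠ a in l, ‖u a * w k * u a‖ ≤ 1 * ‖w k‖ * 1 := hu.mono fun a ha =>
        norm_mul_le_of_le (norm_mul_le_of_le ha le_rfl) ha
      have h1 := isBoundedUnder_le_mul_tendsto_zero (isBoundedUnder_of_eventually_le hb1) ih
      have h2 := isBoundedUnder_le_mul_tendsto_zero (isBoundedUnder_of_eventually_le hu)
        (tendsto_commutator_pow hu (hw k) (2 * L.length + 1))
      have h3 := h2.mul_const (FreeAlgebra.lift ℂ w (L.map (FreeAlgebra.ι ℂ)).prod)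
      have h4 := h1.sub h3
      rw [zero_mul, sub_zero] at h4
      refine h4.congr fun a => ?_
      rw [show 2 * (L.length + 1) = (2 * L.length + 1) + 1 by ring, pow_succ' _ (2 * L.length + 1)]
      rw [pow_succ' _ (2 * L.length)]
      noncomm_ring
  · simpa using tendsto_const_nhds
  · intro x y _ _ hx hy
    have := hx.add hy
    rw [add_zero] at this
    refine this.congr fun a => ?_
    rw [map_add, map_add]
    noncomm_ring
  · intro c x _ hx
    have := hx.const_smul c
    rw [smul_zero] at this
    refine this.congr fun a => ?_
    rw [map_smul, map_smul, smul_sub, mul_smul_comm]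

end Homogeneous

/-! ### Compressing a lift to improve its norm bounds. -/

section Compression

variable {B C : Type*} [CStarAlgebra B] [PartialOrder B] [StarOrderedRing B] [CStarAlgebra C]

/-- Multiply `b` by the cutoff `D / max D √t` of `b* b`. It is `1` on `[0, D²]`, which contains the
spectrum of the image, so `ρ b` is unchanged. -/
theorem StarAlgHom.exists_norm_le_of_norm_map_le (ρ : B →⋆ₐ[ℂ] C) {b : B} {D : ℝ} (hD : 0 < D)
    (hb : ‖ρ b‖ ≤ D) : ∃ x : B, ρ x = ρ b ∧ ‖x‖ ≤ D := by
  have hsa : IsSelfAdjoint (star b * b) := .star_mul_self b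
  have hmax : ∀ t : ℝ, 0 < max D √t := fun t => lt_max_of_lt_left hD
  have hf : Continuous fun t : ℝ => D / max D √t :=
    continuous_const.div₀ (by fun_prop) fun t => (hmax t).ne'
  refine ⟨b * cfc (fun t : ℝ => D / max D √t) (star b * b), ?_, ?_⟩
  · rw [map_mul, StarAlgHomClass.map_cfc ρ _ _ hf.continuousOn ρ.continuous_of_cstar hsa
      (hsa.map ρ), map_mul, map_star]
    rw [cfc_congr (g := fun _ => (1 : ℝ)) fun t ht => ?_,
      cfc_const_one ℝ _ (.star_mul_self (ρ b)), mul_one]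
    have h1 : ‖t‖ ≤ ‖star (ρ b) * ρ b‖ := by
      rcases subsingleton_or_nontrivial C with _ | _
      · rw [spectrum.of_subsingleton] at ht
        exact ht.elim
      exact spectrum.norm_le_norm_of_mem ht
    rw [CStarRing.norm_star_mul_self] at h1
    have h2 : √t ≤ D := by
      rw [Real.sqrt_le_left hD.le]
      exact (le_abs_self t).trans (h1.trans (by rw [sq]; gcongr))
    simp only [max_eq_left h2]
    exact div_self hD.ne'
  · set a := star b * b with ha
    have h1 : ‖b * cfc (fun t : ℝ => D / max D √t) a‖ * ‖b * cfc (fun t : ℝ => D / max D √t) a‖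
        ≤ D ^ 2 := by
      rw [← CStarRing.norm_star_mul_self, star_mul,
        (cfc_predicate _ a : IsSelfAdjoint (cfc (fun t : ℝ => D / max D √t) a)).star_eq]
      have h2 : cfc (fun t : ℝ => D / max D √t) a * star b *
          (b * cfc (fun t : ℝ => D / max D √t) a) =
          cfc (fun t : ℝ => D / max D √t * t * (D / max D √t)) a := by
        rw [cfc_mul (fun t : ℝ => D / max D √t * t) _ a (hf.mul continuous_id).continuousOn
          hf.continuousOn, cfc_mul _ (fun t : ℝ => t) a hf.continuousOn (by fun_prop),
          cfc_id' ℝ a, ha]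
        simp only [mul_assoc]
      rw [h2]
      refine norm_cfc_le (by positivity) fun t ht => ?_
      have ht0 : 0 ≤ t := spectrum_nonneg_of_nonneg (star_mul_self_nonneg b) ht
      have hm := hmax t
      rw [Real.norm_of_nonneg (by positivity), div_mul_eq_mul_div, div_mul_div_comm,
        div_le_iff₀ (by positivity)]
      have h3 : t ≤ max D √t * max D √t := by
        calc t = √t * √t := (Real.mul_self_sqrt ht0).symm
          _ ≤ _ := mul_self_le_mul_self (Real.sqrt_nonneg _) (le_max_right _ _)
      nlinarith [mul_le_mul_of_nonneg_left h3 (sq_nonneg D)]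
    rw [← sq] at h1
    exact (le_abs_self _).trans (abs_le_of_sq_le_sq h1 hD.le)

/-- A compression of a lift that almost satisfies the norm bounds which hold in the quotient, and
that is close to the given lift if the bounds are nearly satisfied already. -/
theorem StarAlgHom.exists_compression (ρ : B →⋆ₐ[ℂ] C) {X κ : Type*} [Finite κ]
    (q : κ → NCPoly X) {d : κ → ℕ} (hd : ∀ j, 1 ≤ d j) (hq : ∀ j, (q j).IsHomogeneous (d j))
    {D : κ → ℝ} (hD : ∀ j, 0 < D j) (w : X → B)
    (hw : ∀ j, ‖FreeAlgebra.lift ℂ (fun k => ρ (w k)) (q j)‖ ≤ D j)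
    {δ : ℝ} (hδ0 : 0 ≤ δ) (hδ1 : δ ≤ 1)
    (hδ : ∀ j, (1 - δ) ^ 2 * ‖FreeAlgebra.lift ℂ w (q j)‖ ≤ D j) {ε : κ → ℝ} (hε : ∀ j, 0 < ε j) :
    ∃ u : B, 0 ≤ u ∧ u ≤ 1 ∧ ‖1 - u‖ ≤ δ ∧ ρ u = 1 ∧
      ∀ j, ‖FreeAlgebra.lift ℂ (fun k => u * w k * u) (q j)‖ ≤ D j + ε j := by
  obtain ⟨l, hl, hle, hlc, hli⟩ := ρ.exists_quasicentral_approx_unit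
  have hle' : ∀ᶠ e in l, 0 ≤ e ∧ e ≤ 1 := hle.mono fun e he => ⟨he.1, he.2.1⟩
  set Q : κ → B := fun j => FreeAlgebra.lift ℂ w (q j) with hQ
  have hρQ : ∀ j, ρ (Q j) = FreeAlgebra.lift ℂ (fun k => ρ (w k)) (q j) := fun j => by
    have : (ρ : B →ₐ[ℂ] C).comp (FreeAlgebra.lift ℂ w) =
        FreeAlgebra.lift ℂ (fun k => ρ (w k)) := by
      ext k
      simp
    exact DFunLike.congr_fun this (q j)
  choose Z hZ hZD using fun j => ρ.exists_norm_le_of_norm_map_le (hD j)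
    (by rw [hρQ]; exact hw j : ‖ρ (Q j)‖ ≤ D j)
  have hu : ∀ e : B, 0 ≤ e ∧ e ≤ 1 → 0 ≤ 1 - δ • e ∧ 1 - δ • e ≤ 1 := fun e he => by
    refine ⟨sub_nonneg.2 ?_, sub_le_self _ (smul_nonneg hδ0 he.1)⟩
    calc δ • e ≤ δ • (1 : B) := smul_le_smul_of_nonneg_left he.2 hδ0
      _ ≤ (1 : ℝ) • (1 : B) := smul_le_smul_of_nonneg_right hδ1 zero_le_one
      _ = 1 := one_smul _ _
  -- Here `1 ≤ d j` enters: the hypothesis only provides two factors `1 - δ`.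
  have hQb : ∀ j, ‖(1 - δ) ^ (2 * d j) • Q j‖ ≤ D j := fun j => by
    rw [norm_smul, Real.norm_of_nonneg (pow_nonneg (sub_nonneg.2 hδ1) _)]
    refine le_trans ?_ (hδ j)
    refine mul_le_mul_of_nonneg_right ?_ (norm_nonneg _)
    exact pow_le_pow_of_le_one (sub_nonneg.2 hδ1) (by linarith) (by have := hd j; omega)
  have hev : ∀ᶠ e in l, ∀ j, ‖FreeAlgebra.lift ℂ (fun k => (1 - δ • e) * w k * (1 - δ • e)) (q j) -
      (1 - δ • e) ^ (2 * d j) * Q j‖ < ε j / 3 ∧ ‖(1 - e) * (Q j - Z j)‖ < ε j / 3 ∧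
      ‖(1 - e) * Z j + e * ((1 - δ) ^ (2 * d j) • Q j)‖ ≤ D j + ε j / 3 := by
    rw [eventually_all]
    intro j
    have hεj := hε j
    have h1 := (hq j).tendsto_lift_conj w (l := l) (u := fun e : B => 1 - δ • e)
      (hle'.mono fun e he =>
        (CStarAlgebra.norm_le_one_iff_of_nonneg _ (hu e he).1).2 (hu e he).2) (fun k => by
        have := (hlc (w k)).const_smul (-δ)
        rw [smul_zero] at this
        refine this.congr fun e => ?_
        simp only [smul_sub, neg_smul, sub_mul, mul_sub, one_mul, mul_one, smul_mul_assoc,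
          mul_smul_comm]
        abel)
    have h2 := hli (Q j - Z j) (by rw [map_sub, hZ, sub_self])
    filter_upwards [Metric.tendsto_nhds.1 h1 (ε j / 3) (by positivity),
      Metric.tendsto_nhds.1 h2 (ε j / 3) (by positivity),
      eventually_norm_interpolation_le hle' (hlc (Z j)) (hlc ((1 - δ) ^ (2 * d j) • Q j))
        (hZD j) (hQb j) (ε := ε j / 3) (by positivity)] with e e1 e2 e3
    rw [dist_zero_right] at e1 e2
    exact ⟨e1, e2, e3⟩
  obtain ⟨e, ⟨he0, he1, hρe⟩, he⟩ := (hle.and hev).exists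
  refine ⟨1 - δ • e, (hu e ⟨he0, he1⟩).1, (hu e ⟨he0, he1⟩).2, ?_, ?_, fun j => ?_⟩
  · rw [sub_sub_cancel, norm_smul, Real.norm_of_nonneg hδ0]
    exact mul_le_of_le_one_right hδ0 ((CStarAlgebra.norm_le_one_iff_of_nonneg e he0).2 he1)
  · rw [map_sub, map_one, ← Complex.coe_smul, map_smul, hρe, smul_zero, sub_zero]
  · obtain ⟨e1, e2, e3⟩ := he j
    have h1 := norm_one_sub_smul_pow_mul_le (Q := Q j) he0 he1 hδ0 hδ1 (2 * d j)
    -- `Q j` is exchanged for the lift `Z j` of norm at most `D j`; their difference lies in the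
    -- kernel, where `1 - e` is small.
    have h2 : (1 - e) * Q j + e * ((1 - δ) ^ (2 * d j) • Q j) =
        ((1 - e) * Z j + e * ((1 - δ) ^ (2 * d j) • Q j)) + (1 - e) * (Q j - Z j) := by
      noncomm_ring
    rw [h2] at h1
    have h3 := h1.trans (norm_add_le_of_le e3 e2.le)
    have h4 := norm_add_le_of_le e1.le h3
    rw [sub_add_cancel] at h4
    linarith

end Compression

/-! ### Lifting order intervals. -/

section OrderLifting

variable {B C : Type*} [CStarAlgebra B] [PartialOrder B] [StarOrderedRing B]
  [CStarAlgebra C] [PartialOrder C] [StarOrderedRing C]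

theorem cfc_sqrt_mul_cfc_sqrt {a : B} (ha : 0 ≤ a) : cfc Real.sqrt a * cfc Real.sqrt a = a := by
  rw [← cfc_mul _ _ a (by fun_prop) (by fun_prop)]
  conv_rhs => rw [← cfc_id' ℝ a]
  exact cfc_congr fun t ht => Real.mul_self_sqrt (spectrum_nonneg_of_nonneg ha ht)

/-- For the norm estimate, `s* s ≤ c` and `b ≤ c` allow both `s` and `√b` to be replaced by `√c`,
leaving `c f(c)`. -/
theorem mul_cfc_mul_norm_le {b c s : B} (hb : 0 ≤ b) (hbc : b ≤ c) (hs : star s * s ≤ c)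
    {f : ℝ → ℝ} (hf : ContinuousOn f (spectrum ℝ c)) {K : ℝ} (hK : 0 ≤ K)
    (hfK : ∀ t ∈ spectrum ℝ c, |t * f t| ≤ K) :
    ‖s * cfc f c * cfc Real.sqrt b‖ ≤ K := by
  have hc : 0 ≤ c := hb.trans hbc
  set D := cfc f c with hD
  set β := cfc Real.sqrt b with hβ
  set γ := cfc Real.sqrt c with hγ
  have hDs : star D = D := (cfc_predicate _ c : IsSelfAdjoint D)
  have hβs : star β = β := (cfc_predicate _ b : IsSelfAdjoint β)
  have hγs : star γ = γ := (cfc_predicate _ c : IsSelfAdjoint γ)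
  have h1 : ‖s * D * β‖ * ‖s * D * β‖ ≤ ‖γ * D * β‖ * ‖γ * D * β‖ := by
    rw [← CStarRing.norm_star_mul_self, ← CStarRing.norm_star_mul_self]
    refine CStarAlgebra.norm_le_norm_of_nonneg_of_le (star_mul_self_nonneg _) ?_
    have := star_left_conjugate_le_conjugate hs (D * β)
    rw [← cfc_sqrt_mul_cfc_sqrt hc, ← hγ] at this
    convert this using 1 <;> simp only [star_mul, mul_assoc, hγs]
  have h2 : ‖γ * D * β‖ * ‖γ * D * β‖ ≤ ‖γ * D * γ‖ * ‖γ * D * γ‖ := by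
    rw [← CStarRing.norm_self_mul_star, ← CStarRing.norm_self_mul_star]
    refine CStarAlgebra.norm_le_norm_of_nonneg_of_le (mul_star_self_nonneg _) ?_
    have h3 : ∀ a : B, star a = a → γ * D * a * star (γ * D * a) =
        γ * D * (a * a) * star (γ * D) := fun a ha => by
      simp only [star_mul, mul_assoc, ha]
    rw [h3 β hβs, h3 γ hγs, cfc_sqrt_mul_cfc_sqrt hb, cfc_sqrt_mul_cfc_sqrt hc]
    exact star_right_conjugate_le_conjugate hbc _
  have h4 : ‖γ * D * γ‖ ≤ K := by
    rw [hγ, hD, ← cfc_mul _ _ c (by fun_prop) hf,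
      ← cfc_mul (fun t => √t * f t) _ c (Real.continuous_sqrt.continuousOn.mul hf)
        Real.continuous_sqrt.continuousOn]
    refine norm_cfc_le hK fun t ht => ?_
    rw [mul_right_comm, Real.mul_self_sqrt (spectrum_nonneg_of_nonneg hc ht)]
    exact hfK t ht
  have h5 := (mul_self_le_mul_self_iff (norm_nonneg _) (norm_nonneg _)).2 (h1.trans h2)
  exact h5.trans h4

/-- A continuous function that agrees with `t ↦ 1 / √t` on `[r, ∞)`. -/
noncomputable def truncInvSqrt (r t : ℝ) : ℝ := 1 / √(max t r)

theorem continuous_truncInvSqrt {r : ℝ} (hr : 0 < r) : Continuous (truncInvSqrt r) :=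
  continuous_const.div₀ (by fun_prop) fun t =>
    (Real.sqrt_pos.2 (lt_max_of_lt_right hr)).ne'

theorem truncInvSqrt_mul_mul_le_one {r t : ℝ} (hr : 0 < r) :
    truncInvSqrt r t * t * truncInvSqrt r t ≤ 1 := by
  have hm : 0 < max t r := lt_max_of_lt_right hr
  have : truncInvSqrt r t * t * truncInvSqrt r t = t / max t r := by
    rw [truncInvSqrt, mul_right_comm, div_mul_div_comm, Real.mul_self_sqrt hm.le]
    ring
  rw [this]
  exact (div_le_one hm).2 (le_max_left _ _)

theorem abs_sqrt_sub_mul_truncInvSqrt_le {r t : ℝ} (hr : 0 < r) (ht : 0 ≤ t) :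
    |√t - t * truncInvSqrt r t| ≤ √r := by
  rcases le_total r t with h | h
  · rw [truncInvSqrt, max_eq_left h, mul_one_div, Real.div_sqrt, sub_self, abs_zero]
    exact Real.sqrt_nonneg _
  · rw [truncInvSqrt, max_eq_right h, mul_one_div]
    have h1 : 0 < √r := Real.sqrt_pos.2 hr
    have h2 : √t ≤ √r := Real.sqrt_le_sqrt h
    have h3 : t / √r ≤ √t := by
      rw [div_le_iff₀ h1]
      calc t = √t * √t := (Real.mul_self_sqrt ht).symm
        _ ≤ √t * √r := by gcongr
    rw [abs_of_nonneg (sub_nonneg.2 h3)]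
    have : 0 ≤ t / √r := by positivity
    linarith

/-- Add to `b` the negative part of `b - z`. It vanishes in the quotient because `ρ b - ρ z` is
already positive. -/
theorem StarAlgHom.exists_majorant (ρ : B →⋆ₐ[ℂ] C) {b z : B} (hb : 0 ≤ b) (hz : 0 ≤ z)
    (h : ρ z ≤ ρ b) : ∃ c, b ≤ c ∧ z ≤ c ∧ ρ c = ρ b := by
  have hsa : IsSelfAdjoint (b - z) := (IsSelfAdjoint.of_nonneg hb).sub (.of_nonneg hz)
  have hp : 0 ≤ cfc (fun t : ℝ => max (-t) 0) (b - z) := cfc_nonneg fun t _ => le_max_right _ _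
  refine ⟨b + cfc (fun t : ℝ => max (-t) 0) (b - z), le_add_of_nonneg_right hp, ?_, ?_⟩
  · have h1 : -(b - z) ≤ cfc (fun t : ℝ => max (-t) 0) (b - z) := by
      conv_lhs => rw [← cfc_id' ℝ (b - z), ← cfc_neg]
      exact cfc_mono (fun t _ => le_max_left _ _) (by fun_prop) (by fun_prop)
    calc z = b + -(b - z) := by abel
      _ ≤ _ := by gcongr
  · rw [map_add, StarAlgHomClass.map_cfc ρ _ _ (by fun_prop) ρ.continuous_of_cstar hsa
      (hsa.map ρ), map_sub, cfc_congr (g := fun _ => (0 : ℝ)) fun t ht => ?_, cfc_const_zero,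
      add_zero]
    have := spectrum_nonneg_of_nonneg (sub_nonneg.2 h) ht
    exact max_eq_right (by linarith)

/-- Order intervals lift along surjective `*`-homomorphisms. -/
theorem StarAlgHom.exists_lift_Icc (ρ : B →⋆ₐ[ℂ] C) (hρ : Function.Surjective ρ) {b : B} {y : C}
    (hb : 0 ≤ b) (hy0 : 0 ≤ y) (hy : y ≤ ρ b) : ∃ x : B, 0 ≤ x ∧ x ≤ b ∧ ρ x = y := by
  set σ := cfc Real.sqrt y with hσ
  have hσs : star σ = σ := (cfc_predicate _ y : IsSelfAdjoint σ)
  have hσσ : star σ * σ = y := by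
    rw [hσs, hσ, cfc_sqrt_mul_cfc_sqrt hy0]
  obtain ⟨s, hs⟩ := hρ σ
  obtain ⟨c, hbc, hzc, hρc⟩ := ρ.exists_majorant hb (star_mul_self_nonneg s)
    (by rwa [map_mul, map_star, hs, hσσ])
  have hc : 0 ≤ c := hb.trans hbc
  set β := cfc Real.sqrt b with hβ
  have hβs : star β = β := (cfc_predicate _ b : IsSelfAdjoint β)
  have hβ0 : IsSelfAdjoint b := .of_nonneg hb
  set r : ℕ → ℝ := fun n => 1 / ((n : ℝ) + 1) with hr
  have hr0 : ∀ n, 0 < r n := fun n => by positivity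
  have hrlim : Tendsto (fun n => √(r n)) atTop (𝓝 0) := by
    have := (Real.continuous_sqrt.tendsto 0).comp
      (tendsto_one_div_add_atTop_nhds_zero_nat (𝕜 := ℝ))
    rwa [Real.sqrt_zero] at this
  have hranti : ∀ {N n}, N ≤ n → √(r n) ≤ √(r N) := fun {N n} h =>
    Real.sqrt_le_sqrt (one_div_le_one_div_of_le (by positivity) (by gcongr))
  have hg := fun n => continuous_truncInvSqrt (hr0 n)
  -- Formally the limit is `s c^(-1/2) b^(1/2)`. Its square is at most `b` since `s* s ≤ c`, and its
  -- image is `σ` since `ρ c = ρ b`. Truncating the inverse square root makes sense of this, and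
  -- `mul_cfc_mul_norm_le` gives convergence.
  set u : ℕ → B := fun n => s * cfc (truncInvSqrt (r n)) c * β with hu
  have hcauchy : CauchySeq u := by
    refine cauchySeq_of_le_tendsto_0 (fun n => √(r n) + √(r n)) (fun n m N hn hm => ?_)
      (by simpa using hrlim.add hrlim)
    have hd : u n - u m =
        s * cfc (fun t => truncInvSqrt (r n) t - truncInvSqrt (r m) t) c * β := by
      rw [cfc_sub _ _ c (hg n).continuousOn (hg m).continuousOn]
      simp only [hu, mul_sub, sub_mul]
    rw [dist_eq_norm, hd]
    refine mul_cfc_mul_norm_le hb hbc hzc ((hg n).sub (hg m)).continuousOn (by positivity)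
      fun t ht => ?_
    have ht0 := spectrum_nonneg_of_nonneg hc ht
    have h1 := (abs_sqrt_sub_mul_truncInvSqrt_le (hr0 n) ht0).trans (hranti hn)
    have h2 := (abs_sqrt_sub_mul_truncInvSqrt_le (hr0 m) ht0).trans (hranti hm)
    change |t * (truncInvSqrt (r n) t - truncInvSqrt (r m) t)| ≤ _
    rw [abs_le] at h1 h2 ⊢
    constructor <;> nlinarith [h1.1, h1.2, h2.1, h2.2]
  obtain ⟨w, hw⟩ := cauchySeq_tendsto_of_complete hcauchy
  refine ⟨star w * w, star_mul_self_nonneg w, ?_, ?_⟩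
  · refine le_of_tendsto (hw.star.mul hw) (Eventually.of_forall fun n => ?_)
    set G := cfc (truncInvSqrt (r n)) c with hG
    have hGs : star G = G := (cfc_predicate _ c : IsSelfAdjoint G)
    have hGc : G * c * G ≤ 1 := by
      have : G * c * G = cfc (fun t => truncInvSqrt (r n) t * t * truncInvSqrt (r n) t) c := by
        rw [cfc_mul (fun t => truncInvSqrt (r n) t * t) _ c
          ((hg n).mul continuous_id).continuousOn (hg n).continuousOn,
          cfc_mul _ (fun t : ℝ => t) c (hg n).continuousOn (by fun_prop), cfc_id' ℝ c]
      rw [this]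
      exact cfc_le_one _ _ fun t _ => truncInvSqrt_mul_mul_le_one (hr0 n)
    calc star (u n) * u n = star (G * β) * (star s * s) * (G * β) := by
          simp only [hu, star_mul, mul_assoc, hG]
      _ ≤ star (G * β) * c * (G * β) := star_left_conjugate_le_conjugate hzc _
      _ = star β * (G * c * G) * β := by simp only [star_mul, mul_assoc, hGs]
      _ ≤ star β * 1 * β := star_left_conjugate_le_conjugate hGc _
      _ = b := by rw [mul_one, hβs, hβ, cfc_sqrt_mul_cfc_sqrt hb]
  · have hρw : ρ w = σ := by
      refine tendsto_nhds_unique ((ρ.continuous_of_cstar.tendsto w).comp hw) ?_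
      rw [tendsto_iff_norm_sub_tendsto_zero]
      refine squeeze_zero (fun n => norm_nonneg _) (fun n => ?_) hrlim
      have hρb : 0 ≤ ρ b := hy0.trans hy
      have hρu : (ρ ∘ u) n =
          σ * (cfc (truncInvSqrt (r n)) (ρ b) * cfc Real.sqrt (ρ b)) := by
        simp only [Function.comp, hu, map_mul, hs, hβ]
        rw [StarAlgHomClass.map_cfc ρ _ _ (hg n).continuousOn ρ.continuous_of_cstar
          (.of_nonneg hc) (IsSelfAdjoint.map (.of_nonneg hc) ρ), hρc,
          StarAlgHomClass.map_cfc ρ _ _ (by fun_prop) ρ.continuous_of_cstar hβ0 (hβ0.map ρ),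
          mul_assoc]
      set H : ℝ → ℝ := fun t => 1 - truncInvSqrt (r n) t * √t with hH
      have hHc : Continuous H := continuous_const.sub ((hg n).mul Real.continuous_sqrt)
      -- `H` need not tend to `0` near `t = 0`, but `σ² ≤ ρ b` supplies a factor `√t`, and `√t H(t)`
      -- is at most `√(r n)`.
      have hd : σ - (ρ ∘ u) n = σ * cfc H (ρ b) := by
        rw [hρu, hH, cfc_sub (fun _ => 1) (fun t => truncInvSqrt (r n) t * √t) (ρ b) (by fun_prop)
          ((hg n).mul Real.continuous_sqrt).continuousOn, cfc_const_one ℝ (ρ b),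
          cfc_mul _ _ _ (hg n).continuousOn (by fun_prop), mul_sub, mul_one]
      rw [← norm_neg, neg_sub, hd]
      have hHs : star (cfc H (ρ b)) = cfc H (ρ b) :=
        (cfc_predicate _ (ρ b) : IsSelfAdjoint (cfc H (ρ b)))
      have h1 : ‖σ * cfc H (ρ b)‖ * ‖σ * cfc H (ρ b)‖ ≤ √(r n) ^ 2 := by
        rw [← CStarRing.norm_star_mul_self]
        calc _ ≤ ‖cfc H (ρ b) * ρ b * cfc H (ρ b)‖ := by
              refine CStarAlgebra.norm_le_norm_of_nonneg_of_le (star_mul_self_nonneg _) ?_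
              have := star_left_conjugate_le_conjugate (hσσ.trans_le hy) (cfc H (ρ b))
              convert this using 1
              · simp only [star_mul, mul_assoc]
              · rw [hHs]
          _ = ‖cfc (fun t => H t * t * H t) (ρ b)‖ := by
              rw [cfc_mul (fun t => H t * t) _ (ρ b) (hHc.mul continuous_id).continuousOn
                hHc.continuousOn, cfc_mul _ (fun t : ℝ => t) (ρ b) hHc.continuousOn
                (by fun_prop), cfc_id' ℝ (ρ b)]
          _ ≤ √(r n) ^ 2 := by
              refine norm_cfc_le (by positivity) fun t ht => ?_
              have ht0 := spectrum_nonneg_of_nonneg hρb ht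
              have h2 : H t * t * H t = (√t - t * truncInvSqrt (r n) t) ^ 2 := by
                have h3 : √t * H t = √t - t * truncInvSqrt (r n) t := by
                  rw [hH]
                  calc √t * (1 - truncInvSqrt (r n) t * √t) =
                        √t - (√t * √t) * truncInvSqrt (r n) t := by ring
                    _ = _ := by rw [Real.mul_self_sqrt ht0]
                rw [← h3, mul_pow, Real.sq_sqrt ht0]
                ring
              rw [h2, norm_pow, Real.norm_eq_abs]
              gcongr
              exact abs_sqrt_sub_mul_truncInvSqrt_le (hr0 n) ht0
      rw [← sq] at h1
      exact (le_abs_self _).trans (abs_le_of_sq_le_sq h1 (Real.sqrt_nonneg _))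
    rw [map_mul, map_star, hρw, hσσ]

end OrderLifting

/-- The order relations `0 ≤ h ≤ 1` and `-C k • h ≤ x k ≤ C k • h`, with `h = v none` and
`x k = v (some k)`, in a unital algebra. -/
structure OrderConeRelations {ι A : Type*} [CStarAlgebra A] [PartialOrder A] (C : ι → ℝ)
    (v : Option ι → A) : Prop where
  nonneg : 0 ≤ v none
  le_one : v none ≤ 1
  lower : ∀ k, -(C k • v none) ≤ v (some k)
  upper : ∀ k, v (some k) ≤ C k • v none

/-! ### Lifting the relations along unital surjections. -/

section UnitalLifting

variable {ι : Type*} {B E : Type*} [CStarAlgebra B] [PartialOrder B] [StarOrderedRing B]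
  [CStarAlgebra E] [PartialOrder E] [StarOrderedRing E] {C : ι → ℝ}

theorem OrderConeRelations.conj {w : Option ι → B} (hw : OrderConeRelations C w) {u : B}
    (hu0 : 0 ≤ u) (hu1 : u ≤ 1) : OrderConeRelations C fun k => u * w k * u := by
  have hs : star u = u := (IsSelfAdjoint.of_nonneg hu0).star_eq
  have hmono : ∀ {a b : B}, a ≤ b → u * a * u ≤ u * b * u := fun {a b} h => by
    have := star_left_conjugate_le_conjugate h u
    rwa [hs] at this
  have h0 : 0 ≤ u * w none * u := by simpa using hmono hw.nonneg
  refine ⟨h0, ?_, fun k => ?_, fun k => ?_⟩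
  · rw [← CStarAlgebra.norm_le_one_iff_of_nonneg _ h0]
    have hun := (CStarAlgebra.norm_le_one_iff_of_nonneg u hu0).2 hu1
    have hwn := (CStarAlgebra.norm_le_one_iff_of_nonneg _ hw.nonneg).2 hw.le_one
    exact (norm_mul_le_of_le (norm_mul_le_of_le hun hwn) hun).trans (by norm_num)
  · have := hmono (hw.lower k)
    rwa [mul_neg, neg_mul, mul_smul_comm, smul_mul_assoc] at this
  · have := hmono (hw.upper k)
    rwa [mul_smul_comm, smul_mul_assoc] at this

theorem OrderConeRelations.of_tendsto {w : ℕ → Option ι → B} {v : Option ι → B}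
    (hw : ∀ n, OrderConeRelations C (w n))
    (h : ∀ k, Tendsto (fun n => w n k) atTop (𝓝 (v k))) : OrderConeRelations C v where
  nonneg := ge_of_tendsto' (h none) fun n => (hw n).nonneg
  le_one := le_of_tendsto' (h none) fun n => (hw n).le_one
  lower k := le_of_tendsto_of_tendsto' ((h none).const_smul (C k)).neg (h (some k))
    fun n => (hw n).lower k
  upper k := le_of_tendsto_of_tendsto' (h (some k)) ((h none).const_smul (C k))
    fun n => (hw n).upper k

theorem OrderConeRelations.exists_lift (ρ : B →⋆ₐ[ℂ] E) (hρ : Function.Surjective ρ)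
    (hC : ∀ k, 0 < C k) {v : Option ι → E} (hv : OrderConeRelations C v) :
    ∃ w : Option ι → B, (∀ k, ρ (w k) = v k) ∧ OrderConeRelations C w := by
  have hsmul : ∀ (c : ℝ) (b : B), ρ (c • b) = c • ρ b := fun c b => by
    rw [← Complex.coe_smul, map_smul, Complex.coe_smul]
  obtain ⟨h, h0, h1, hh⟩ := ρ.exists_lift_Icc hρ zero_le_one hv.nonneg
    (by rw [map_one]; exact hv.le_one)
  have hx : ∀ k, ∃ x : B, -(C k • h) ≤ x ∧ x ≤ C k • h ∧ ρ x = v (some k) := by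
    intro k
    -- Shifting by `C k • h` turns the symmetric interval into one that starts at `0`.
    obtain ⟨y, hy0, hy1, hy⟩ := ρ.exists_lift_Icc hρ (b := C k • h + C k • h)
      (y := v (some k) + C k • v none)
      (add_nonneg (smul_nonneg (hC k).le h0) (smul_nonneg (hC k).le h0))
      (neg_le_iff_add_nonneg.1 (hv.lower k))
      (by rw [map_add, hsmul, hh]; exact add_le_add (hv.upper k) le_rfl)
    refine ⟨y - C k • h, ?_, sub_le_iff_le_add.2 hy1, ?_⟩
    · rw [neg_le_sub_iff_le_add]
      exact le_add_of_nonneg_left hy0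
    · rw [map_sub, hy, hsmul, hh, add_sub_cancel_right]
  choose x hx0 hx1 hx using hx
  refine ⟨fun k => k.elim h x, ?_, h0, h1, hx0, hx1⟩
  rintro (_ | k)
  · exact hh
  · exact hx k

theorem tendsto_freeAlgebra_lift {B X : Type*} [NormedRing B] [NormedAlgebra ℂ B]
    {w : ℕ → X → B} {v : X → B}
    (h : ∀ k, Tendsto (fun n => w n k) atTop (𝓝 (v k))) (q : NCPoly X) :
    Tendsto (fun n => FreeAlgebra.lift ℂ (w n) q) atTop (𝓝 (FreeAlgebra.lift ℂ v q)) := by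
  induction q using FreeAlgebra.induction with
  | grade0 r => simp
  | grade1 x => simpa using h x
  | mul a b ha hb => simpa using ha.mul hb
  | add a b ha hb => simpa using ha.add hb

/-- Families satisfying the order relations and norm bounds on homogeneous polynomials lift along
surjective `*`-homomorphisms. -/
theorem OrderConeRelations.exists_lift_norm_le (ρ : B →⋆ₐ[ℂ] E) (hρ : Function.Surjective ρ)
    (hC : ∀ k, 0 < C k) {κ : Type*} [Finite κ] (q : κ → NCPoly (Option ι)) {d : κ → ℕ}
    (hd : ∀ j, 1 ≤ d j) (hq : ∀ j, (q j).IsHomogeneous (d j)) {D : κ → ℝ} (hD : ∀ j, 0 < D j)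
    {v : Option ι → E} (hv : OrderConeRelations C v)
    (hvq : ∀ j, ‖FreeAlgebra.lift ℂ v (q j)‖ ≤ D j) :
    ∃ w : Option ι → B, (∀ k, ρ (w k) = v k) ∧ OrderConeRelations C w ∧
      ∀ j, ‖FreeAlgebra.lift ℂ w (q j)‖ ≤ D j := by
  obtain ⟨w₀, hw₀, hw₀'⟩ := hv.exists_lift ρ hρ hC
  -- The bound by `‖w₀ k‖` gives all stages the same displacement constant, so that the
  -- displacements sum geometrically.
  let S : (Option ι → B) → Prop := fun w =>
    (∀ k, ρ (w k) = v k) ∧ OrderConeRelations C w ∧ ∀ k, ‖w k‖ ≤ ‖w₀ k‖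
  have step : ∀ w, S w → ∀ δ : ℝ, 0 ≤ δ → δ ≤ 1 →
      (∀ j, (1 - δ) ^ 2 * ‖FreeAlgebra.lift ℂ w (q j)‖ ≤ D j) → ∀ ε : ℝ, 0 < ε →
      ∃ w', S w' ∧ (∀ k, ‖w k - w' k‖ ≤ 2 * ‖w₀ k‖ * δ) ∧
        ∀ j, ‖FreeAlgebra.lift ℂ w' (q j)‖ ≤ D j * (1 + ε) := by
    rintro w ⟨hwv, hw, hwn⟩ δ hδ0 hδ1 hδ ε hε
    have hwv' : (fun k => ρ (w k)) = v := funext hwv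
    obtain ⟨u, hu0, hu1, huδ, hρu, hu⟩ := ρ.exists_compression q hd hq hD w
      (by rw [hwv']; exact hvq) hδ0 hδ1 hδ (ε := fun j => D j * ε)
      fun j => mul_pos (hD j) hε
    have hun := (CStarAlgebra.norm_le_one_iff_of_nonneg u hu0).2 hu1
    refine ⟨fun k => u * w k * u, ⟨fun k => ?_, hw.conj hu0 hu1, fun k => ?_⟩, fun k => ?_,
      fun j => ?_⟩
    · rw [map_mul, map_mul, hρu, one_mul, mul_one, hwv]
    · exact (norm_mul_le_of_le (norm_mul_le_of_le hun (hwn k)) hun).trans (by simp)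
    · have : w k - u * w k * u = (1 - u) * w k + u * w k * (1 - u) := by noncomm_ring
      rw [this]
      refine (norm_add_le_of_le (norm_mul_le_of_le huδ (hwn k))
        (norm_mul_le_of_le (norm_mul_le_of_le hun (hwn k)) huδ)).trans (le_of_eq ?_)
      ring
    · rw [mul_add, mul_one]
      exact hu j
  -- With `δ = 1` the smallness condition is void, so an arbitrary lift can be brought to the bound
  -- `2 * D j` that starts the iteration.
  obtain ⟨w₁, hw₁, -, hw₁q⟩ := step w₀ ⟨hw₀, hw₀', fun k => le_rfl⟩ 1 zero_le_one le_rfl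
    (fun j => by simpa using (hD j).le) 1 one_pos
  let T : ℕ → Type _ := fun n =>
    {w : Option ι → B // S w ∧ ∀ j, ‖FreeAlgebra.lift ℂ w (q j)‖ ≤ D j * (1 + (1 / 2) ^ n)}
  have next : ∀ n (w : T n), ∃ w' : T (n + 1), ∀ k,
      ‖w.1 k - w'.1 k‖ ≤ 2 * ‖w₀ k‖ * (1 / 2) ^ n := by
    rintro n ⟨w, hw, hwq⟩
    have h0 : (0 : ℝ) ≤ (1 / 2) ^ n := by positivity
    have h1 : (1 / 2 : ℝ) ^ n ≤ 1 := pow_le_one₀ (by norm_num) (by norm_num)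
    obtain ⟨w', hw', hd', hq'⟩ := step w hw ((1 / 2) ^ n) h0 h1 (fun j => by
      -- With `δ = 2 ^ (-n)` this is `(1 - δ) (1 - δ²) ≤ 1`: an excess factor `1 + δ` is absorbed by
      -- a compression of size `δ`.
      have h2 : (1 - (1 / 2 : ℝ) ^ n) ^ 2 * (1 + (1 / 2) ^ n) ≤ 1 := by
        nlinarith [mul_nonneg h0 (sub_nonneg.2 h1), mul_nonneg (sq_nonneg ((1 / 2 : ℝ) ^ n))
          (sub_nonneg.2 h1)]
      calc _ ≤ (1 - (1 / 2 : ℝ) ^ n) ^ 2 * (D j * (1 + (1 / 2) ^ n)) := by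
            gcongr; exact hwq j
        _ = D j * ((1 - (1 / 2 : ℝ) ^ n) ^ 2 * (1 + (1 / 2) ^ n)) := by ring
        _ ≤ D j * 1 := by gcongr; exact (hD j).le
        _ = D j := mul_one _) ((1 / 2) ^ (n + 1)) (by positivity)
    exact ⟨⟨w', hw', hq'⟩, hd'⟩
  choose f hf using next
  let W : ∀ n, T n := fun n => Nat.rec ⟨w₁, hw₁, by simpa using hw₁q⟩ (fun n w => f n w) n
  have hW : ∀ n k, dist ((W n).1 k) ((W (n + 1)).1 k) ≤ 2 * ‖w₀ k‖ * (1 / 2) ^ n := fun n k => by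
    rw [dist_eq_norm]
    exact hf n (W n) k
  have hlim : ∀ k, ∃ x, Tendsto (fun n => (W n).1 k) atTop (𝓝 x) := fun k =>
    cauchySeq_tendsto_of_complete (cauchySeq_of_le_geometric (1 / 2) _ (by norm_num)
      fun n => hW n k)
  choose w hw using hlim
  refine ⟨w, fun k => ?_, .of_tendsto (fun n => (W n).2.1.2.1) hw, fun j => ?_⟩
  · refine tendsto_nhds_unique ((ρ.continuous_of_cstar.tendsto _).comp (hw k)) ?_
    refine tendsto_const_nhds.congr fun n => ((W n).2.1.1 k).symm
  · have h1 : Tendsto (fun n : ℕ => D j * (1 + (1 / 2 : ℝ) ^ n)) atTop (𝓝 (D j * (1 + 0))) :=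
      ((tendsto_pow_atTop_nhds_zero_of_lt_one (by norm_num) (by norm_num)).const_add 1).const_mul _
    rw [add_zero, mul_one] at h1
    exact le_of_tendsto_of_tendsto' (tendsto_freeAlgebra_lift hw (q j)).norm h1
      fun n => (W n).2.2 j

end UnitalLifting

/-! ### From unitizations back to nonunital algebras, and projectivity. -/

section Transfer

variable {ι : Type*} {J : ℕ} {C : ι → ℝ} {q : Fin J → NCPoly (Option ι)} {D : Fin J → ℝ}

theorem Unitization.inr_le_inr_iff_of_cstar {A : Type*} [NonUnitalCStarAlgebra A] [PartialOrder A]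
    [StarOrderedRing A] {a b : A} : (a : Unitization ℂ A) ≤ b ↔ a ≤ b := by
  rw [← sub_nonneg, ← Unitization.inr_sub, Unitization.inr_nonneg_iff, sub_nonneg]

theorem coneLikeRelations_iff {A : Type*} [NonUnitalCStarAlgebra A] [PartialOrder A]
    [StarOrderedRing A] {v : Option ι → A} :
    ConeLikeRelations C q D A v ↔
      OrderConeRelations C (fun k => (v k : Unitization ℂ A)) ∧ ∀ j, ‖(q j).eval v‖ ≤ D j := by
  have hsmul : ∀ k, C k • (v none : Unitization ℂ A) = ((C k • v none : A) : Unitization ℂ A) :=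
    fun k => (Unitization.inr_smul ℂ (C k) (v none)).symm
  refine ⟨fun h => ⟨⟨Unitization.inr_nonneg_iff.2 h.nonneg, h.le_one, fun k => ?_, fun k => ?_⟩,
    h.norm_le⟩, fun ⟨h, h'⟩ => ⟨Unitization.inr_nonneg_iff.1 h.nonneg, h.le_one, fun k => ?_,
    fun k => ?_, h'⟩⟩
  · rw [hsmul, ← Unitization.inr_neg]
    exact Unitization.inr_le_inr_iff_of_cstar.2 (h.lower k)
  · rw [hsmul]
    exact Unitization.inr_le_inr_iff_of_cstar.2 (h.upper k)
  · have := h.lower k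
    rw [hsmul, ← Unitization.inr_neg] at this
    exact Unitization.inr_le_inr_iff_of_cstar.1 this
  · have := h.upper k
    rw [hsmul] at this
    exact Unitization.inr_le_inr_iff_of_cstar.1 this

theorem OrderConeRelations.map {A B : Type*} [CStarAlgebra A] [PartialOrder A] [StarOrderedRing A]
    [CStarAlgebra B] [PartialOrder B] [StarOrderedRing B] (ρ : A →⋆ₐ[ℂ] B) {v : Option ι → A}
    (h : OrderConeRelations C v) : OrderConeRelations C fun k => ρ (v k) := by
  have hmono : Monotone ρ := OrderHomClass.mono ρ
  have hsmul : ∀ k, C k • ρ (v none) = ρ (C k • v none) := fun k => by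
    rw [← Complex.coe_smul, ← map_smul, Complex.coe_smul]
  refine ⟨by simpa using hmono h.nonneg, by simpa using hmono h.le_one, fun k => ?_, fun k => ?_⟩
  · rw [hsmul, ← map_neg]
    exact hmono (h.lower k)
  · rw [hsmul]
    exact hmono (h.upper k)

theorem NCPoly.eval_map {X A B : Type*} [NonUnitalCStarAlgebra A] [NonUnitalCStarAlgebra B]
    (φ : A →⋆ₙₐ[ℂ] B) (v : X → A) (q : NCPoly X) :
    q.eval (fun k => φ (v k)) = Unitization.starMap φ (q.eval v) := by
  have : FreeAlgebra.lift ℂ (fun i => ((φ (v i) : B) : Unitization ℂ B)) =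
      (Unitization.starMap φ : Unitization ℂ A →ₐ[ℂ] Unitization ℂ B).comp
        (FreeAlgebra.lift ℂ (fun i => ((v i : A) : Unitization ℂ A))) := by
    ext k
    all_goals simp
  exact DFunLike.congr_fun this q

theorem ConeLikeRelations.map {A B : Type*} [NonUnitalCStarAlgebra A] [PartialOrder A]
    [StarOrderedRing A] [NonUnitalCStarAlgebra B] [PartialOrder B] [StarOrderedRing B]
    (φ : A →⋆ₙₐ[ℂ] B) {v : Option ι → A} (h : ConeLikeRelations C q D A v) :
    ConeLikeRelations C q D B fun k => φ (v k) := by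
  rw [coneLikeRelations_iff] at h ⊢
  refine ⟨?_, fun j => ?_⟩
  · simpa using h.1.map (Unitization.starMap φ)
  · rw [NCPoly.eval_map]
    exact (NonUnitalStarAlgHom.norm_apply_le _ _).trans (h.2 j)

theorem ConeLikeRelations.exists_lift {A B : Type*} [NonUnitalCStarAlgebra A] [PartialOrder A]
    [StarOrderedRing A] [NonUnitalCStarAlgebra B] [PartialOrder B] [StarOrderedRing B]
    {d : Fin J → ℕ} (hd : ∀ j, 1 ≤ d j) (hq : ∀ j, (q j).IsHomogeneous (d j))
    (hC : ∀ k, 0 < C k) (hD : ∀ j, 0 < D j)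
    (ρ : B →⋆ₙₐ[ℂ] A) (hρ : Function.Surjective ρ) {v : Option ι → A}
    (h : ConeLikeRelations C q D A v) :
    ∃ w : Option ι → B, (∀ k, ρ (w k) = v k) ∧ ConeLikeRelations C q D B w := by
  rw [coneLikeRelations_iff] at h
  obtain ⟨w, hwv, hw, hwq⟩ := h.1.exists_lift_norm_le (Unitization.starMap ρ)
    (Unitization.starMap_surjective hρ) hC q hd hq hD h.2
  -- The unitized map preserves scalar parts, so lifts of elements of `A` automatically lie in `B`.
  have hfst : ∀ x : Unitization ℂ B, (Unitization.starMap ρ x).toProd.1 = x.toProd.1 ∧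
      (Unitization.starMap ρ x).toProd.2 = ρ x.toProd.2 := fun x => by
    rw [← Unitization.inl_fst_add_inr_snd_eq x]
    simp [Unitization.algebraMap_eq_inl]
  have hinr : ∀ k, ((w k).toProd.2 : Unitization ℂ B) = w k := fun k => by
    refine Unitization.ext ?_ rfl
    rw [← (hfst (w k)).1, hwv]
    rfl
  refine ⟨fun k => (w k).toProd.2, fun k => ?_, coneLikeRelations_iff.2 ⟨?_, fun j => ?_⟩⟩
  · rw [← (hfst (w k)).2, hwv]
    rfl
  · simpa only [hinr] using hw
  · simpa only [NCPoly.eval, hinr] using hwq j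

theorem IsUniversalCStarAlgebra.isProjective {ι : Type v} {J : ℕ} {C : ι → ℝ}
    {q : Fin J → NCPoly (Option ι)} {D : Fin J → ℝ}
    {d : Fin J → ℕ} (hd : ∀ j, 1 ≤ d j) (hq : ∀ j, (q j).IsHomogeneous (d j))
    (hC : ∀ k, 0 < C k) (hD : ∀ j, 0 < D j)
    {P : Type u} [NonUnitalCStarAlgebra P] [PartialOrder P] [StarOrderedRing P]
    {g : Option ι → P}
    (hP : IsUniversalCStarAlgebra.{u, v} (fun A => ConeLikeRelations C q D A) P g) :
    IsProjectiveCStarAlgebra P := by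
  intro B A _ _ ρ hρ φ
  let _ := CStarAlgebra.spectralOrder B
  have := CStarAlgebra.spectralOrderedRing B
  let _ := CStarAlgebra.spectralOrder A
  have := CStarAlgebra.spectralOrderedRing A
  have hφ := hP.rel.map φ
  obtain ⟨w, hwv, hw⟩ := hφ.exists_lift hd hq hC hD ρ hρ
  obtain ⟨ψ, hψ, -⟩ := hP.existsUnique_hom B w hw
  refine ⟨ψ, (hP.existsUnique_hom A _ hφ).unique (fun i => ?_) fun i => rfl⟩
  rw [NonUnitalStarAlgHom.comp_apply, hψ, hwv]

end Transfer

/-! ### Extending maps from generators by density. -/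

section Extension

variable {X : Type*} {P A : Type*} [NonUnitalCStarAlgebra P] [NonUnitalCStarAlgebra A]

theorem FreeNonUnitalNonAssocAlgebra.lift_mem (S : NonUnitalSubalgebra ℂ P) {g : X → P}
    (hg : ∀ k, g k ∈ S) (f : FreeNonUnitalNonAssocAlgebra ℂ X) :
    FreeNonUnitalNonAssocAlgebra.lift ℂ g f ∈ S := by
  have h : (NonUnitalSubalgebraClass.subtype S).comp
      (FreeNonUnitalNonAssocAlgebra.lift ℂ fun k => (⟨g k, hg k⟩ : S)) =
      FreeNonUnitalNonAssocAlgebra.lift ℂ g := by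
    refine FreeNonUnitalNonAssocAlgebra.hom_ext ℂ fun k => ?_
    simp [FreeNonUnitalNonAssocAlgebra.lift_of_apply]
  rw [← h]
  exact (FreeNonUnitalNonAssocAlgebra.lift ℂ (fun k => (⟨g k, hg k⟩ : S)) f).2

theorem FreeNonUnitalNonAssocAlgebra.map_lift (φ : P →⋆ₙₐ[ℂ] A) (g : X → P)
    (f : FreeNonUnitalNonAssocAlgebra ℂ X) :
    φ (FreeNonUnitalNonAssocAlgebra.lift ℂ g f) =
      FreeNonUnitalNonAssocAlgebra.lift ℂ (fun k => φ (g k)) f := by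
  have h : (φ : P →ₙₐ[ℂ] A).comp (FreeNonUnitalNonAssocAlgebra.lift ℂ g) =
      FreeNonUnitalNonAssocAlgebra.lift ℂ fun k => φ (g k) := by
    refine FreeNonUnitalNonAssocAlgebra.hom_ext ℂ fun k => ?_
    simp [FreeNonUnitalNonAssocAlgebra.lift_of_apply]
    rfl
  exact DFunLike.congr_fun h f

/-- A map from self-adjoint topological generators extends uniquely to a `*`-homomorphism if it
does not increase the norms of polynomials. -/
theorem NonUnitalStarAlgHom.existsUnique_of_norm_lift_le {g : X → P} {v : X → A}
    (hg : ∀ k, IsSelfAdjoint (g k)) (hv : ∀ k, IsSelfAdjoint (v k))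
    (hd : DenseRange (FreeNonUnitalNonAssocAlgebra.lift ℂ g))
    (hn : ∀ f, ‖FreeNonUnitalNonAssocAlgebra.lift ℂ v f‖ ≤
      ‖FreeNonUnitalNonAssocAlgebra.lift ℂ g f‖) :
    ∃! φ : P →⋆ₙₐ[ℂ] A, ∀ k, φ (g k) = v k := by
  set G := FreeNonUnitalNonAssocAlgebra.lift ℂ g with hG
  set V := FreeNonUnitalNonAssocAlgebra.lift ℂ v with hV
  let T : P →L[ℂ] A := (V : FreeNonUnitalNonAssocAlgebra ℂ X →ₗ[ℂ] A).extendOfNorm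
    (G : FreeNonUnitalNonAssocAlgebra ℂ X →ₗ[ℂ] P)
  have hT : ∀ f, T (G f) = V f := fun f =>
    LinearMap.extendOfNorm_eq (f := (V : FreeNonUnitalNonAssocAlgebra ℂ X →ₗ[ℂ] A))
      (e := (G : FreeNonUnitalNonAssocAlgebra ℂ X →ₗ[ℂ] P)) hd
      ⟨1, fun x => by rw [one_mul]; exact hn x⟩ f
  have hTg : ∀ k, T (g k) = v k := fun k => by
    have := hT (FreeNonUnitalNonAssocAlgebra.of ℂ k)
    simpa [hG, hV] using this
  have hTmul : ∀ x y, T (x * y) = T x * T y := fun x y => by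
    refine hd.induction_on₂ (p := fun x y => T (x * y) = T x * T y)
      (isClosed_eq (by fun_prop) (by fun_prop)) (fun a b => ?_) x y
    rw [← map_mul G, hT, hT, hT, map_mul]
  have hTstar : ∀ x, T (star x) = star (T x) := by
    let S : NonUnitalSubalgebra ℂ P :=
      { carrier := {x | T (star x) = star (T x)}
        add_mem' := fun {a b} ha hb => by
          simp only [Set.mem_ofPred_eq, star_add, map_add] at ha hb ⊢
          rw [ha, hb]
        zero_mem' := by simp
        mul_mem' := fun {a b} ha hb => by
          simp only [Set.mem_ofPred_eq, star_mul, hTmul] at ha hb ⊢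
          rw [ha, hb]
        smul_mem' := fun c a ha => by
          simp only [Set.mem_ofPred_eq, star_smul, map_smul] at ha ⊢
          rw [ha] }
    intro x
    refine hd.induction_on (p := fun x => T (star x) = star (T x)) x
      (isClosed_eq (by fun_prop) (by fun_prop)) fun f => ?_
    refine FreeNonUnitalNonAssocAlgebra.lift_mem S (fun k => ?_) f
    change T (star (g k)) = star (T (g k))
    rw [(hg k).star_eq, hTg, (hv k).star_eq]
  let φ : P →⋆ₙₐ[ℂ] A :=
    { toFun := T
      map_smul' := fun c x => by simp
      map_zero' := map_zero T
      map_add' := map_add T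
      map_mul' := hTmul
      map_star' := hTstar }
  have hcont : ∀ ψ : P →⋆ₙₐ[ℂ] A, Continuous ψ := fun ψ =>
    AddMonoidHomClass.continuous_of_bound ψ 1 fun x => by
      rw [one_mul]; exact NonUnitalStarAlgHom.norm_apply_le ψ x
  refine ⟨φ, hTg, fun ψ hψ => DFunLike.coe_injective ?_⟩
  refine hd.equalizer (hcont ψ) (hcont φ) (funext fun f => ?_)
  simp only [Function.comp]
  rw [hG, FreeNonUnitalNonAssocAlgebra.map_lift, FreeNonUnitalNonAssocAlgebra.map_lift, funext hψ,
    funext (show ∀ k, φ (g k) = v k from hTg)]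

theorem denseRange_lift_topologicalClosure_adjoin {L : Type*} [NonUnitalCStarAlgebra L]
    {g : X → L} (hg : ∀ k, IsSelfAdjoint (g k))
    {S : NonUnitalStarSubalgebra ℂ L}
    (hS : S = (NonUnitalStarAlgebra.adjoin ℂ (Set.range g)).topologicalClosure)
    (g' : X → S) (hg' : ∀ k, (g' k : L) = g k) :
    DenseRange (FreeNonUnitalNonAssocAlgebra.lift ℂ g') := by
  have hval : ∀ f, ((FreeNonUnitalNonAssocAlgebra.lift ℂ g' f : S) : L) =
      FreeNonUnitalNonAssocAlgebra.lift ℂ g f := by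
    intro f
    have h : (NonUnitalSubalgebraClass.subtype S).comp (FreeNonUnitalNonAssocAlgebra.lift ℂ g') =
        FreeNonUnitalNonAssocAlgebra.lift ℂ g := by
      refine FreeNonUnitalNonAssocAlgebra.hom_ext ℂ fun k => ?_
      simp [FreeNonUnitalNonAssocAlgebra.lift_of_apply]
      exact hg' k
    exact DFunLike.congr_fun h f
  intro x
  rw [closure_subtype]
  have hx : (x : L) ∈ closure ((NonUnitalStarAlgebra.adjoin ℂ (Set.range g) : Set L)) :=
    hS.le x.2
  refine closure_mono ?_ hx
  have hle : NonUnitalAlgebra.adjoin ℂ (Set.range g ∪ star (Set.range g)) ≤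
      NonUnitalAlgHom.range (FreeNonUnitalNonAssocAlgebra.lift ℂ g) := by
    refine NonUnitalAlgebra.adjoin_le ?_
    have hmem : ∀ k, g k ∈ NonUnitalAlgHom.range (FreeNonUnitalNonAssocAlgebra.lift ℂ g) :=
      fun k => ⟨FreeNonUnitalNonAssocAlgebra.of ℂ k,
        FreeNonUnitalNonAssocAlgebra.lift_of_apply ..⟩
    rintro y (⟨k, rfl⟩ | ⟨k, hk⟩)
    · exact hmem k
    · rw [← star_star y, ← hk, (hg k).star_eq]
      exact hmem k
  rintro y hy
  obtain ⟨f, hf⟩ := hle hy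
  exact ⟨_, ⟨f, rfl⟩, (hval f).trans hf⟩

end Extension

/-! ### Universal C*-algebras of bounded systems of relations. -/

section Existence

variable {X : Type}

/-- A family of elements of a C*-algebra that satisfies the relations `R`. -/
structure CStarRelations.Model (R : CStarRelations.{u, 0} X) : Type (u + 1) where
  Carrier : Type u
  [cstar : NonUnitalCStarAlgebra Carrier]
  [order : PartialOrder Carrier]
  [orderedRing : StarOrderedRing Carrier]
  val : X → Carrier
  rel : R Carrier val

attribute [instance] CStarRelations.Model.cstar CStarRelations.Model.order
  CStarRelations.Model.orderedRing

/-- The norms that a model induces on polynomials in the generators. -/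
noncomputable def CStarRelations.Model.polyNorm {R : CStarRelations.{u, 0} X} (M : R.Model)
    (f : FreeNonUnitalNonAssocAlgebra ℂ X) : ℝ :=
  ‖FreeNonUnitalNonAssocAlgebra.lift ℂ M.val f‖

/-- The bounds `K` put the generators in an `ℓ^∞` product of models, and `hR` transfers the
relations to the subalgebra they generate. A homomorphism to any model exists because the product
norm dominates the norm of that model on polynomials. -/
theorem CStarRelations.exists_isUniversal (R : CStarRelations.{u, 0} X) (K : X → ℝ)
    (hK : ∀ (A : Type u) [NonUnitalCStarAlgebra A] [PartialOrder A] [StarOrderedRing A]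
      (v : X → A), R A v → ∀ k, IsSelfAdjoint (v k) ∧ ‖v k‖ ≤ K k)
    (hR : ∀ (P : Type u) [NonUnitalCStarAlgebra P] [PartialOrder P] [StarOrderedRing P]
      (g : X → P) (I : Type) (A : I → Type u) [∀ i, NonUnitalCStarAlgebra (A i)]
      [∀ i, PartialOrder (A i)] [∀ i, StarOrderedRing (A i)] (π : ∀ i, P →⋆ₙₐ[ℂ] A i),
      (∀ a c, 0 ≤ c → (∀ i, ‖π i a‖ ≤ c) → ‖a‖ ≤ c) →
      (∀ i, R (A i) fun k => π i (g k)) → R P g) :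
    ∃ (P : Type u) (_ : NonUnitalCStarAlgebra P) (_ : PartialOrder P) (_ : StarOrderedRing P)
      (g : X → P), IsUniversalCStarAlgebra R P g := by
  -- Models form a type in universe `u + 1`, but only their norms on polynomials matter. One
  -- representative per norm function gives an index in `Type`, so the product stays in `Type u`.
  let I : Type := {N : FreeNonUnitalNonAssocAlgebra ℂ X → ℝ // ∃ M : R.Model, M.polyNorm = N}
  let M : I → R.Model := fun i => i.2.choose
  have hM : ∀ i : I, (M i).polyNorm = i.1 := fun i => i.2.choose_spec
  let A : I → Type u := fun i => (M i).Carrier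
  have hMK : ∀ i k, IsSelfAdjoint ((M i).val k) ∧ ‖(M i).val k‖ ≤ K k := fun i =>
    hK _ _ (M i).rel
  let g₀ : X → lp A ∞ := fun k => ⟨fun i => (M i).val k, memℓp_infty ⟨K k, by
    rintro _ ⟨i, rfl⟩
    exact (hMK i k).2⟩⟩
  have hg₀ : ∀ k, IsSelfAdjoint (g₀ k) := fun k => lp.ext (funext fun i => (hMK i k).1)
  let S : NonUnitalStarSubalgebra ℂ (lp A ∞) :=
    (NonUnitalStarAlgebra.adjoin ℂ (Set.range g₀)).topologicalClosure
  have hSc : IsClosed (S : Set (lp A ∞)) :=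
    NonUnitalStarSubalgebra.isClosed_topologicalClosure _
  let _ : NonUnitalCStarAlgebra S := NonUnitalStarSubalgebra.nonUnitalCStarAlgebra S
  let _ := CStarAlgebra.spectralOrder S
  have hSo := CStarAlgebra.spectralOrderedRing S
  let g : X → S := fun k => ⟨g₀ k, NonUnitalStarSubalgebra.le_topologicalClosure _
    (NonUnitalStarAlgebra.subset_adjoin ℂ _ ⟨k, rfl⟩)⟩
  let π : ∀ i, S →⋆ₙₐ[ℂ] A i := fun i =>
    { toFun := fun x => (x : lp A ∞) i
      map_smul' := fun c x => rfl
      map_zero' := rfl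
      map_add' := fun x y => rfl
      map_mul' := fun x y => rfl
      map_star' := fun x => rfl }
  have hd : DenseRange (FreeNonUnitalNonAssocAlgebra.lift ℂ g) :=
    denseRange_lift_topologicalClosure_adjoin hg₀ rfl g fun k => rfl
  refine ⟨S, inferInstance, inferInstance, hSo, g, ?_, ?_⟩
  · exact hR S g I A π (fun a c hc h => lp.norm_le_of_forall_le hc h) fun i => (M i).rel
  · intro B _ _ _ v hv
    refine NonUnitalStarAlgHom.existsUnique_of_norm_lift_le (fun k => Subtype.ext (hg₀ k))
      (fun k => (hK B v hv k).1) hd fun f => ?_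
    let N : R.Model := ⟨B, v, hv⟩
    let i : I := ⟨N.polyNorm, N, rfl⟩
    calc ‖FreeNonUnitalNonAssocAlgebra.lift ℂ v f‖ = (M i).polyNorm f := by rw [hM i]; rfl
      _ = ‖π i (FreeNonUnitalNonAssocAlgebra.lift ℂ g f)‖ := by
          rw [FreeNonUnitalNonAssocAlgebra.map_lift]; rfl
      _ ≤ _ := NonUnitalStarAlgHom.norm_apply_le _ _

end Existence

/-! ### The given relations are bounded and detected by jointly isometric families. -/

section ConeLike

/-- The negative part is given by functional calculus, hence commutes with each `π i`; it is killed
by all of them and so is zero. -/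
theorem nonneg_of_forall_map_nonneg {P I : Type*} {A : I → Type*} [NonUnitalCStarAlgebra P]
    [PartialOrder P] [StarOrderedRing P] [∀ i, NonUnitalCStarAlgebra (A i)]
    [∀ i, PartialOrder (A i)] [∀ i, StarOrderedRing (A i)] (π : ∀ i, P →⋆ₙₐ[ℂ] A i)
    (hπ : ∀ a, (∀ i, π i a = 0) → a = 0) {a : P} (ha : ∀ i, 0 ≤ π i a) : 0 ≤ a := by
  have hsa : IsSelfAdjoint a := sub_eq_zero.1 (hπ (star a - a) fun i => by
    rw [map_sub, map_star, (IsSelfAdjoint.of_nonneg (ha i)).star_eq, sub_self])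
  rw [← CFC.negPart_eq_zero_iff a hsa]
  refine hπ _ fun i => ?_
  have hcont : Continuous (π i) := AddMonoidHomClass.continuous_of_bound (π i) 1 fun x => by
    rw [one_mul]; exact NonUnitalStarAlgHom.norm_apply_le (π i) x
  have h := (CFC.negPart_eq_zero_iff (π i a) (.of_nonneg (ha i))).2 (ha i)
  rw [CFC.negPart_def] at h ⊢
  rw [NonUnitalStarAlgHomClass.map_cfcₙ (π i) _ a (by fun_prop) (by simp) hcont hsa (hsa.map (π i))]
  exact h

variable {ι : Type*} {J : ℕ} {C : ι → ℝ} {q : Fin J → NCPoly (Option ι)} {D : Fin J → ℝ}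

/-- The constant `3 * C k` is `2 * C k` for the positive element `x k + C k • h` plus `C k` for the
shift; only finiteness matters. -/
theorem ConeLikeRelations.isSelfAdjoint_and_norm_le (hC : ∀ k, 0 < C k) {A : Type*}
    [NonUnitalCStarAlgebra A] [PartialOrder A] [StarOrderedRing A] {v : Option ι → A}
    (h : ConeLikeRelations C q D A v) (k : Option ι) :
    IsSelfAdjoint (v k) ∧ ‖v k‖ ≤ k.elim 1 fun k => 3 * C k := by
  have h1 : ‖v none‖ ≤ 1 :=
    (CStarAlgebra.inr_mem_Icc_iff_norm_le.1 ⟨Unitization.inr_nonneg_iff.2 h.nonneg, h.le_one⟩).2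
  cases k with
  | none => exact ⟨.of_nonneg h.nonneg, h1⟩
  | some k =>
    have hs : IsSelfAdjoint (C k • v none) := .of_nonneg (smul_nonneg (hC k).le h.nonneg)
    have h0 : 0 ≤ v (some k) + C k • v none := neg_le_iff_add_nonneg.1 (h.lower k)
    have hCn : ‖C k • v none‖ ≤ C k := by
      rw [norm_smul, Real.norm_of_nonneg (hC k).le]
      exact mul_le_of_le_one_right (hC k).le h1
    have h2 : ‖v (some k) + C k • v none‖ ≤ C k + C k :=
      (CStarAlgebra.norm_le_norm_of_nonneg_of_le h0 (add_le_add (h.upper k) le_rfl)).trans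
        (norm_add_le_of_le hCn hCn)
    refine ⟨?_, ?_⟩
    · have := (IsSelfAdjoint.of_nonneg h0).sub hs
      rwa [add_sub_cancel_right] at this
    · have := norm_sub_le_of_le h2 hCn
      rw [add_sub_cancel_right] at this
      exact this.trans (by simp only [Option.elim]; linarith)

/-- A word of positive length has a first letter in `A`, which is an ideal of the unitization. Norm
bounds on polynomials can thus be tested inside the algebra itself. -/
theorem NCPoly.IsHomogeneous.exists_eval_eq_inr {X A : Type*} [NonUnitalCStarAlgebra A]
    {q : NCPoly X} {d : ℕ} (hq : q.IsHomogeneous d) (hd : 1 ≤ d) (v : X → A) :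
    ∃ a : A, q.eval v = a := by
  refine Submodule.span_induction (p := fun q _ => ∃ a : A, NCPoly.eval v q = a) ?_ ?_ ?_ ?_ hq
  · rintro _ ⟨L, rfl, rfl⟩
    cases L with
    | nil => simp at hd
    | cons k L =>
      refine ⟨(NCPoly.eval v (L.map (FreeAlgebra.ι ℂ)).prod).toProd.1 • v k +
        v k * (NCPoly.eval v (L.map (FreeAlgebra.ι ℂ)).prod).toProd.2, ?_⟩
      rw [NCPoly.eval, List.map_cons, List.prod_cons, map_mul, FreeAlgebra.lift_ι_apply]
      refine Unitization.ext ?_ ?_ <;> simp [NCPoly.eval]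
  · exact ⟨0, by simp [NCPoly.eval]⟩
  · rintro x y _ _ ⟨a, ha⟩ ⟨b, hb⟩
    refine ⟨a + b, ?_⟩
    rw [NCPoly.eval] at ha hb ⊢
    rw [map_add, ha, hb, Unitization.inr_add]
  · rintro c x _ ⟨a, ha⟩
    refine ⟨c • a, ?_⟩
    rw [NCPoly.eval] at ha ⊢
    rw [map_smul, ha, Unitization.inr_smul]

theorem ConeLikeRelations.of_forall_map {P I : Type*} {A : I → Type*} [NonUnitalCStarAlgebra P]
    [PartialOrder P] [StarOrderedRing P] [∀ i, NonUnitalCStarAlgebra (A i)]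
    [∀ i, PartialOrder (A i)] [∀ i, StarOrderedRing (A i)]
    {d : Fin J → ℕ} (hd : ∀ j, 1 ≤ d j) (hq : ∀ j, (q j).IsHomogeneous (d j))
    (hD : ∀ j, 0 < D j) {g : Option ι → P} (π : ∀ i, P →⋆ₙₐ[ℂ] A i)
    (hπ : ∀ a c, 0 ≤ c → (∀ i, ‖π i a‖ ≤ c) → ‖a‖ ≤ c)
    (h : ∀ i, ConeLikeRelations C q D (A i) fun k => π i (g k)) : ConeLikeRelations C q D P g := by
  have hπ0 : ∀ a, (∀ i, π i a = 0) → a = 0 := fun a ha =>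
    norm_le_zero_iff.1 (hπ a 0 le_rfl fun i => by rw [ha i, norm_zero])
  have hsmul : ∀ i (c : ℝ) a, π i (c • a) = c • π i a := fun i c a => by
    rw [← Complex.coe_smul, map_smul, Complex.coe_smul]
  have hpos : ∀ {a : P}, (∀ i, 0 ≤ π i a) → 0 ≤ a := nonneg_of_forall_map_nonneg π hπ0
  have h0 : 0 ≤ g none := hpos fun i => (h i).nonneg
  refine ⟨h0, ?_, fun k => ?_, fun k => ?_, fun j => ?_⟩
  · refine (CStarAlgebra.inr_mem_Icc_iff_norm_le.2 ⟨h0, hπ _ 1 zero_le_one fun i => ?_⟩).2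
    exact (CStarAlgebra.inr_mem_Icc_iff_norm_le.1
      ⟨Unitization.inr_nonneg_iff.2 (h i).nonneg, (h i).le_one⟩).2
  · rw [← sub_nonneg]
    refine hpos fun i => ?_
    rw [map_sub, map_neg, hsmul, sub_nonneg]
    exact (h i).lower k
  · rw [← sub_nonneg]
    refine hpos fun i => ?_
    rw [map_sub, hsmul, sub_nonneg]
    exact (h i).upper k
  · obtain ⟨a, ha⟩ := (hq j).exists_eval_eq_inr (hd j) g
    rw [ha, Unitization.norm_inr]
    refine hπ a _ (hD j).le fun i => ?_
    have := (h i).norm_le j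
    rwa [NCPoly.eval_map, ha, Unitization.starMap_inr, Unitization.norm_inr] at this

end ConeLike

theorem theorem7p2 {ι : Type} [Countable ι] (J : ℕ)
    (q : Fin J → NCPoly (Option ι)) (d : Fin J → ℕ) (hd : ∀ j, 1 ≤ d j)
    (hq : ∀ j, (q j).IsHomogeneous (d j))
    (C : ι → ℝ) (hC : ∀ k, 0 < C k) (D : Fin J → ℝ) (hD : ∀ j, 0 < D j) :
    (∃ (P : Type u) (_ : NonUnitalCStarAlgebra P) (_ : PartialOrder P) (_ : StarOrderedRing P)
      (g : Option ι → P), IsUniversalCStarAlgebra (fun A => ConeLikeRelations C q D A) P g) ∧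
    ∀ (P : Type u) [NonUnitalCStarAlgebra P] [PartialOrder P] [StarOrderedRing P]
      (g : Option ι → P), IsUniversalCStarAlgebra (fun A => ConeLikeRelations C q D A) P g →
      IsProjectiveCStarAlgebra P := by
  refine ⟨CStarRelations.exists_isUniversal _ (fun k => k.elim 1 fun k => 3 * C k)
    (fun A _ _ _ v hv k => hv.isSelfAdjoint_and_norm_le hC k)
    fun P _ _ _ g I A _ _ _ π hπ h => .of_forall_map hd hq hD π hπ h, ?_⟩
  intro P _ _ _ g hP
  exact hP.isProjective hd hq hC hD
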